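/- **Setting.** Let $X\subset\mathbb{R}^n$ be nonempty, closed and convex; let $f_0:\mathbb{R}^n\to\mathbb{R}$ be $C^1$ and convex; let $F=(f_1,\dots,f_m):\mathbb{R}^n\to\mathbb{R}^m$ have $C^1$ components and suppose that for each $i$ there is $L_i>0$ with $\|\nabla f_i(x)-\nabla f_i(x')\|_2\le\tfrac12L_i\|x-x'\|_2$ for all $x,x'\in X$; let $h:\mathbb{R}^m\to\mathbb{R}$ be convex with $|h(z)-h(z')|\le L_h\|z-z'\|_2$ for all $z,z'\in\mathbb{R}^m$ and some $L_h>0$. Consider the problem of minimizing $f_0(x)+h(F(x))$ over $x\in X$. Let $N_X$ be the normal cone of convex analysis (empty outside $X$), $\partial$ the convex subdifferential, and $$S(x,y,z)=\{F(x)-z\}\times(\partial h(z)-y)\times\Big(\nabla f_0(x)+\sum_{i=1}^m y_i\nabla f_i(x)+N_X(x)\Big)\subset\mathbb{R}^m\times\mathbb{R}^m\times\mathbb{R}^n .$$ Distances are Euclidean and $\operatorname{dist}(0,\emptyset)=\infty$. A *lower model* of $h$ is a convex function $\mathfrak h:\mathbb{R}^m\to\mathbb{R}$ with $\mathfrak h\le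 h$. **Algorithm** (composite proximal bundle method). Data: $x_0\in X$, $\kappa\in(0,1)$, $\tau>1$, $0<\underline t<t_0<t_{\max}<\infty$, $\mathrm{Tol}\ge0$. Set $\hat x_0=x_0$, take $\hat s_0\in\partial h(F(\hat x_0))$ and a lower model $\mathfrak h_0$ of $h$. For $k=0,1,2,\dots$: 1. Compute $(x_{k+1},y_{k+1},z_{k+1})$ with $z_{k+1}=F(\hat x_k)+\nabla F(\hat x_k)(x_{k+1}-\hat x_k)$, $y_{k+1}\in\partial\mathfrak h_k(z_{k+1})$ and $-\nabla f_0(x_{k+1})-\nabla F(\hat x_k)^\top y_{k+1}-\tfrac1{t_k}(x_{k+1}-\hat x_k)\in N_X(x_{k+1})$. 2. Set $v_k=f_0(\hat x_k)+h(F(\hat x_k))-\big(f_0(x_{k+1})+\mathfrak h_k(z_{k+1})\big)$. If $v_k\le\mathrm{Tol}$, stop and return $x_{k+1}$. 3. If $f_0(x_{k+1})+h(z_{k+1})\le f_0(\hat x_k)+h(F(\hat x_k))-\kappa v_k$, then: - (serious step) if also $f_0(x_{k+1})+h(F(x_{k+1}))\le f_0(\hat x_k)+h(F(\hat x_k))-\tfrac\kappa2v_k$,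 set $\hat x_{k+1}=x_{k+1}$, choose $t_{k+1}\in[t_k,t_{\max}]$, $\hat s_{k+1}\in\partial h(F(\hat x_{k+1}))$ and a lower model $\mathfrak h_{k+1}$ of $h$ with $h(F(\hat x_{k+1}))+\langle\hat s_{k+1},z-F(\hat x_{k+1})\rangle\le\mathfrak h_{k+1}(z)$ for all $z$; - (backtracking step) otherwise set $\hat x_{k+1}=\hat x_k$, $\hat s_{k+1}=\hat s_k$, $t_{k+1}=t_k/\tau$, replace $\underline t$ by $\min\{t_k/\tau,\underline t\}$, and update the model as in ($*$). 4. (null step) If the first test in 3 fails, set $\hat x_{k+1}=\hat x_k$, $\hat s_{k+1}=\hat s_k$, choose $t_{k+1}\in[\underline t,t_k]$, and update the model as in ($*$). ($*$) Choose $s_{k+1}\in\partial h(z_{k+1})$ and a lower model $\mathfrak h_{k+1}$ of $h$ such that, for all $z$, $\mathfrak h_{k+1}(z)$ is at least each of $h(F(\hat x_k))+\langle\hat s_k,z-F(\hat x_k)\rangle$, $h(z_{k+1})+\langle s_{k+1},z-z_{k+1}\rangle$ and $\mathfrak h_k(z_{k+1})+\langle y_{k+1},z-z_{k+1}\rangle$.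 **Theorem.** Suppose that $\{x\in X: f_0(x)+h(F(x))\le f_0(x_0)+h(F(x_0))\}$ is bounded. (0) For every $\mathrm{Tol}\ge0$ the algorithm is well-defined: it can be initialized, every partial execution can be continued (until the algorithm stops, or indefinitely), and $x_{k+1}$, $z_{k+1}$, hence $v_k$, are uniquely determined by the data at the beginning of iteration $k$. (1) Let $\mathrm{Tol}=0$. Every execution either stops in some iteration $k$, and then $x^\star=\hat x_k=x_{k+1}$ satisfies $0\in S(x^\star,y^\star,F(x^\star))$ for some $y^\star\in\mathbb{R}^m$; or it continues indefinitely. In the latter case, if the models have uniformly bounded subgradients on bounded sets (for every bounded $C\subset\mathbb{R}^m$ there is $M_C>0$ with $\|y\|\le M_C$ for all $k$, $z\in C$, $y\in\partial\mathfrak h_k(z)$), then $\liminf_k v_k=0$ and every cluster point $x^\star$ of $\{\hat x_k\}$ satisfies $0\in S(x^\star,y^\star,F(x^\star))$ for some $y^\star\in\mathbb{R}^m$. (2) For the given problem and the given $x_0,\kappa,\tau,\underline t,t_0,t_{\max}$ there are numbers $\epsilon_{\mathrm{Tol}}\ge0$, $\mathrm{Tol}>0$, with $\epsilon_{\mathrm{Tol}}\to0$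 as $\mathrm{Tol}\downarrow0$, such that for every $\mathrm{Tol}>0$ every execution stops in some iteration $k_{\mathrm{Tol}}$, and its last iterate $x_{\mathrm{Tol}}=x_{k_{\mathrm{Tol}}+1}$ satisfies $\operatorname{dist}\big(0,S(x_{\mathrm{Tol}},y^\star,z^\star)\big)\le\epsilon_{\mathrm{Tol}}$ for some $y^\star,z^\star\in\mathbb{R}^m$. -/

import Mathlib

open scoped Pointwise

namespace CompositeBundle

/-- `ℝⁿ` with the Euclidean norm. -/
abbrev E (n : ℕ) : Type := EuclideanSpace ℝ (Fin n)

/-! ### Convex analysis -/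

/-- The subdifferential of a real-valued convex function `g` at `z`. -/
def subdiff {m : ℕ} (g : E m → ℝ) (z : E m) : Set (E m) :=
  {y | ∀ w : E m, g z + inner ℝ y (w - z) ≤ g w}

/-- The normal cone to a convex set `X` at `x`; it is empty when `x ∉ X`. -/
def normalCone {n : ℕ} (X : Set (E n)) (x : E n) : Set (E n) :=
  {v | x ∈ X ∧ ∀ x' ∈ X, inner ℝ v (x' - x) ≤ 0}

/-- `g` is a lower model of `h`: a convex real-valued minorant. -/
def IsLowerModel {m : ℕ} (h g : E m → ℝ) : Prop :=
  ConvexOn ℝ Set.univ g ∧ ∀ z, g z ≤ h z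

/-- The affine function `z ↦ c + ⟨s, z - z₀⟩` is a minorant of `g`. -/
def Minorizes {m : ℕ} (c : ℝ) (s z₀ : E m) (g : E m → ℝ) : Prop :=
  ∀ z : E m, c + inner ℝ s (z - z₀) ≤ g z

/-! ### The composite problem: minimize `f₀ x + h (F x)` over `x ∈ X` -/

structure Problem (n m : ℕ) where
  X : Set (E n)
  f₀ : E n → ℝ
  F : E n → E m
  h : E m → ℝ

namespace Problem

variable {n m : ℕ}

/-- The objective function. -/
def obj (P : Problem n m) (x : E n) : ℝ := P.f₀ x + P.h (P.F x)

/-- The `i`-th component function of `F`. -/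
def comp (P : Problem n m) (i : Fin m) (x : E n) : ℝ := P.F x i

/-- The standing assumptions on the data of the problem. -/
structure Assumptions (P : Problem n m) : Prop where
  nonempty_X : P.X.Nonempty
  closed_X : IsClosed P.X
  convex_X : Convex ℝ P.X
  smooth_f₀ : ContDiff ℝ 1 P.f₀
  convex_f₀ : ConvexOn ℝ Set.univ P.f₀
  smooth_F : ∀ i : Fin m, ContDiff ℝ 1 (P.comp i)
  lipschitz_grad : ∀ i : Fin m, ∃ L : ℝ, 0 < L ∧ ∀ x ∈ P.X, ∀ x' ∈ P.X,
    ‖gradient (P.comp i) x - gradient (P.comp i) x'‖ ≤ 1 / 2 * L * ‖x - x'‖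
  convex_h : ConvexOn ℝ Set.univ P.h
  lipschitz_h : ∃ L : ℝ, 0 < L ∧ ∀ z z' : E m, |P.h z - P.h z'| ≤ L * ‖z - z'‖

/-- The problem is level-bounded for `x₀`. -/
def LevelBounded (P : Problem n m) (x₀ : E n) : Prop :=
  Bornology.IsBounded {x | x ∈ P.X ∧ P.obj x ≤ P.obj x₀}

/-- The set-valued mapping of first-order information on the component functions. For smooth
component functions it is `Dᵢ(x) = {∇fᵢ(x)}`. -/
def D (P : Problem n m) (i : Fin m) (x : E n) : Set (E n) := {gradient (P.comp i) x}

/-- The set-valued mapping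
`S(x,y,z) = {F(x) - z} × (∂h(z) - y) × (∇f₀(x) + ∑ᵢ yᵢ con Dᵢ(x) + N_X(x))`,
as a subset of the product space with its Euclidean norm. -/
def S (P : Problem n m) (x : E n) (y z : E m) :
    Set (WithLp 2 (E m × WithLp 2 (E m × E n))) :=
  {w | w.fst ∈ ({P.F x - z} : Set (E m)) ∧
    w.snd.fst ∈ subdiff P.h z - ({y} : Set (E m)) ∧
    w.snd.snd ∈ ({gradient P.f₀ x} : Set (E n))
      + ∑ i : Fin m, y i • convexHull ℝ (P.D i x) + normalCone P.X x}

end Problem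

/-! ### The composite proximal bundle method -/

/-- The parameters of the algorithm (apart from the tolerance); `tlow` is the initial value of
the lower threshold `t̲` for the prox-parameters. -/
structure Params (n : ℕ) where
  x₀ : E n
  κ : ℝ
  τ : ℝ
  tlow : ℝ
  t₀ : ℝ
  tmax : ℝ

structure Params.Valid {n m : ℕ} (A : Params n) (P : Problem n m) : Prop where
  x₀_mem : A.x₀ ∈ P.X
  κ_pos : 0 < A.κ
  κ_lt : A.κ < 1
  one_lt_τ : 1 < A.τ
  tlow_pos : 0 < A.tlow
  tlow_lt : A.tlow < A.t₀
  t₀_lt : A.t₀ < A.tmax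

/-- What the algorithm holds at the beginning of iteration `k`: the stability center `x̂ₖ`, the
subgradient `ŝₖ ∈ ∂h(F(x̂ₖ))`, the prox-parameter `tₖ`, the current value of the threshold `t̲`,
and the model `𝔥ₖ`. -/
structure State (n m : ℕ) where
  center : E n
  slope : E m
  t : ℝ
  tlow : ℝ
  model : E m → ℝ

/-- The triple `(xₖ₊₁, yₖ₊₁, zₖ₊₁)` computed in iteration `k`. -/
structure Trial (n m : ℕ) where
  x : E n
  y : E m
  z : E m

section Algorithm

variable {n m : ℕ}

/-- Initialization. -/
structure IsInit (P : Problem n m) (A : Params n) (s : State n m) : Prop where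
  center_eq : s.center = A.x₀
  slope_mem : s.slope ∈ subdiff P.h (P.F s.center)
  t_eq : s.t = A.t₀
  tlow_eq : s.tlow = A.tlow
  lower : IsLowerModel P.h s.model

/-- The optimality conditions of the master problem. -/
structure IsTrial (P : Problem n m) (s : State n m) (T : Trial n m) : Prop where
  z_eq : T.z = P.F s.center + fderiv ℝ P.F s.center (T.x - s.center)
  y_mem : T.y ∈ subdiff s.model T.z
  x_opt : -gradient P.f₀ T.x - (ContinuousLinearMap.adjoint (fderiv ℝ P.F s.center)) T.y
      - (1 / s.t) • (T.x - s.center) ∈ normalCone P.X T.x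

/-- The predicted decrease `vₖ`. -/
def predDecrease (P : Problem n m) (s : State n m) (T : Trial n m) : ℝ :=
  P.f₀ s.center + P.h (P.F s.center) - (P.f₀ T.x + s.model T.z)

/-- The first descent test, on the linearized problem. -/
def Test₁ (P : Problem n m) (A : Params n) (s : State n m) (T : Trial n m) : Prop :=
  P.f₀ T.x + P.h T.z ≤ P.f₀ s.center + P.h (P.F s.center) - A.κ * predDecrease P s T

/-- The second descent test, on the actual problem. -/
def Test₂ (P : Problem n m) (A : Params n) (s : State n m) (T : Trial n m) : Prop :=
  P.f₀ T.x + P.h (P.F T.x) ≤ P.f₀ s.center + P.h (P.F s.center) - A.κ / 2 * predDecrease P s T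

/-- The update of the state in a serious step. -/
structure SeriousStep (P : Problem n m) (A : Params n) (s : State n m) (T : Trial n m)
    (s' : State n m) : Prop where
  center_eq : s'.center = T.x
  t_mem : s'.t ∈ Set.Icc s.t A.tmax
  tlow_eq : s'.tlow = s.tlow
  slope_mem : s'.slope ∈ subdiff P.h (P.F s'.center)
  lower : IsLowerModel P.h s'.model
  minorizes : Minorizes (P.h (P.F s'.center)) s'.slope (P.F s'.center) s'.model

/-- The requirement on the new model in backtracking and null steps: it is a lower model above
three linearizations. -/
def ModelUpdate (P : Problem n m) (s : State n m) (T : Trial n m) (s' : State n m) : Prop :=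
  IsLowerModel P.h s'.model ∧
  Minorizes (P.h (P.F s.center)) s.slope (P.F s.center) s'.model ∧
  (∃ g ∈ subdiff P.h T.z, Minorizes (P.h T.z) g T.z s'.model) ∧
  Minorizes (s.model T.z) T.y T.z s'.model

/-- The update of the state in a backtracking step. -/
structure BacktrackingStep (P : Problem n m) (A : Params n) (s : State n m) (T : Trial n m)
    (s' : State n m) : Prop where
  center_eq : s'.center = s.center
  slope_eq : s'.slope = s.slope
  t_eq : s'.t = s.t / A.τ
  tlow_eq : s'.tlow = min (s.t / A.τ) s.tlow
  model : ModelUpdate P s T s'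

/-- The update of the state in a null step. -/
structure NullStep (P : Problem n m) (s : State n m) (T : Trial n m) (s' : State n m) : Prop where
  center_eq : s'.center = s.center
  slope_eq : s'.slope = s.slope
  t_mem : s'.t ∈ Set.Icc s.tlow s.t
  tlow_eq : s'.tlow = s.tlow
  model : ModelUpdate P s T s'

/-- The update of the state at the end of an iteration that does not stop. -/
def Update (P : Problem n m) (A : Params n) (s : State n m) (T : Trial n m)
    (s' : State n m) : Prop :=
  (Test₁ P A s T → Test₂ P A s T → SeriousStep P A s T s') ∧
  (Test₁ P A s T → ¬ Test₂ P A s T → BacktrackingStep P A s T s') ∧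
  (¬ Test₁ P A s T → NullStep P s T s')

end Algorithm

/-- A record of an execution: `state k` and `trial k` belong to iteration `k`. The entries after
the algorithm has stopped carry no meaning and are not constrained. -/
structure Run (n m : ℕ) where
  state : ℕ → State n m
  trial : ℕ → Trial n m

namespace Run

variable {n m : ℕ}

/-- The stability center `x̂ₖ`. -/
def center (r : Run n m) (k : ℕ) : E n := (r.state k).center

/-- The point `xₖ₊₁` computed in iteration `k`. -/
def next (r : Run n m) (k : ℕ) : E n := (r.trial k).x

/-- The predicted decrease `vₖ`. -/
def v (P : Problem n m) (r : Run n m) (k : ℕ) : ℝ := predDecrease P (r.state k) (r.trial k)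

/-- Iteration `k` is carried out: the algorithm has not stopped before. -/
def Active (P : Problem n m) (Tol : ℝ) (r : Run n m) (k : ℕ) : Prop :=
  ∀ j < k, Tol < r.v P j

/-- The algorithm stops in iteration `k` (and returns `xₖ₊₁`). -/
def StopsAt (P : Problem n m) (Tol : ℝ) (r : Run n m) (k : ℕ) : Prop :=
  r.Active P Tol k ∧ r.v P k ≤ Tol

/-- If iteration `k` is carried out, then it follows the rules of the algorithm. -/
def Obeys (P : Problem n m) (A : Params n) (Tol : ℝ) (r : Run n m) (k : ℕ) : Prop :=
  r.Active P Tol k →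
    IsTrial P (r.state k) (r.trial k) ∧
    (Tol < r.v P k → Update P A (r.state k) (r.trial k) (r.state (k + 1)))

/-- `r` records the initialization and the iterations `0, …, K - 1` of the algorithm. -/
def IsPartial (P : Problem n m) (A : Params n) (Tol : ℝ) (K : ℕ) (r : Run n m) : Prop :=
  IsInit P A (r.state 0) ∧ ∀ k < K, r.Obeys P A Tol k

/-- `r` records a complete execution of the algorithm, finite or infinite. -/
def IsExecution (P : Problem n m) (A : Params n) (Tol : ℝ) (r : Run n m) : Prop :=
  IsInit P A (r.state 0) ∧ ∀ k, r.Obeys P A Tol k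

/-- The models have uniformly bounded subgradients on bounded sets. -/
def BoundedSubgradients (P : Problem n m) (Tol : ℝ) (r : Run n m) : Prop :=
  ∀ C : Set (E m), Bornology.IsBounded C → ∃ M : ℝ, 0 < M ∧
    ∀ k, r.Active P Tol k → ∀ z ∈ C, ∀ y ∈ subdiff (r.state k).model z, ‖y‖ ≤ M

end Run

/-- The algorithm is well-defined: it can be initialized, the points `xₖ₊₁` and `zₖ₊₁` are
determined by the data at the beginning of iteration `k`, and every partial execution can be
continued to a complete one. -/
def WellDefined {n m : ℕ} (P : Problem n m) (A : Params n) (Tol : ℝ) : Prop :=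
  (∃ s : State n m, IsInit P A s) ∧
  (∀ r : Run n m, r.IsExecution P A Tol → ∀ k, r.Active P Tol k →
    ∀ T : Trial n m, IsTrial P (r.state k) T →
      T.x = (r.trial k).x ∧ T.z = (r.trial k).z) ∧
  (∀ (K : ℕ) (r : Run n m), r.IsPartial P A Tol K →
    ∃ r' : Run n m, r'.IsExecution P A Tol ∧
      (∀ k ≤ K, r'.state k = r.state k) ∧ (∀ k < K, r'.trial k = r.trial k))

end CompositeBundle

/-!
The linearization of the model at the trial point is an `ε`-subgradient of `h` at the image of the
center with `ε ≤ v`, and the step has length at most `√(tmax * v)`. By Brøndsted–Rockafellar the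
trial point is therefore stationary up to a residual which vanishes with `v`, and it suffices that
`v` becomes small while the center stays unchanged.

If there are infinitely many serious steps, this holds because each of them decreases the
objective, which is bounded below, by at least `κ / 2 * v`. Otherwise there are finitely many
backtracking steps, because the second test is passed once `t` is small and so `t` stays bounded
away from `0`. Only null steps remain. They increase the optimal value of the master problem, which
is bounded above, and strong convexity forces consecutive trial points together; failure of the
first test then turns into `v (k + 1) ≤ κ * v k + o(1)`.
-/

namespace CompositeBundle

open Filter Topology
open scoped NNReal

/-! ### Real sequences -/

theorem tendsto_sub_succ_of_le {a : ℕ → ℝ} {b : ℝ} (ha : ∀ᶠ k in atTop, a (k + 1) ≤ a k)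
    (hb : ∀ᶠ k in atTop, b ≤ a k) : Tendsto (fun k => a k - a (k + 1)) atTop (𝓝 0) := by
  obtain ⟨K, hK⟩ := eventually_atTop.1 (ha.and hb)
  have hanti : Antitone fun j => a (j + K) :=
    antitone_nat_of_succ_le fun j => by
      simpa only [Nat.add_right_comm] using (hK (j + K) (Nat.le_add_left K j)).1
  have hbdd : BddBelow (Set.range fun j => a (j + K)) :=
    ⟨b, Set.forall_mem_range.2 fun j => (hK (j + K) (Nat.le_add_left K j)).2⟩
  have hlim := (tendsto_add_atTop_iff_nat K).1 (tendsto_atTop_ciInf hanti hbdd)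
  simpa only [sub_self, Function.comp_apply] using hlim.sub (hlim.comp (tendsto_add_atTop_nat 1))

theorem tendsto_zero_of_succ_le_mul_add {a e : ℕ → ℝ} {κ : ℝ} (hκ₀ : 0 ≤ κ) (hκ₁ : κ < 1)
    (ha₀ : ∀ k, 0 ≤ a k) (ha : ∀ᶠ k in atTop, a (k + 1) ≤ κ * a k + e k)
    (he : Tendsto e atTop (𝓝 0)) : Tendsto a atTop (𝓝 0) := by
  refine tendsto_order.2 ⟨fun ε hε => .of_forall fun k => hε.trans_le (ha₀ k), fun ε hε => ?_⟩
  have hsmall : 0 < (1 - κ) * (ε / 2) := mul_pos (sub_pos.2 hκ₁) (half_pos hε)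
  obtain ⟨N, hN⟩ := eventually_atTop.1 (ha.and (he.eventually_lt_const hsmall))
  have hgeom : ∀ j, a (j + N) ≤ κ ^ j * a N + ε / 2 := by
    intro j
    induction j with
    | zero => rw [zero_add, pow_zero, one_mul]; linarith
    | succ j ih =>
      obtain ⟨hstep, hej⟩ := hN (j + N) (Nat.le_add_left N j)
      calc a (j + 1 + N) ≤ κ * a (j + N) + (1 - κ) * (ε / 2) := by
            rw [Nat.add_right_comm]; linarith
        _ ≤ κ * (κ ^ j * a N + ε / 2) + (1 - κ) * (ε / 2) := by gcongr
        _ = κ ^ (j + 1) * a N + ε / 2 := by ring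
  have hpow : Tendsto (fun j => κ ^ j * a N) atTop (𝓝 0) := by
    simpa only [zero_mul] using (tendsto_pow_atTop_nhds_zero_of_lt_one hκ₀ hκ₁).mul_const (a N)
  rw [← map_add_atTop_eq_nat N, eventually_map]
  filter_upwards [hpow.eventually_lt_const (half_pos hε)] with j hj
  linarith [hgeom j]

/-! ### Separation and subgradients -/

section Separation

variable {V : Type*} [AddCommGroup V] [TopologicalSpace V] [IsTopologicalAddGroup V] [Module ℝ V]
  [ContinuousSMul ℝ V]

theorem exists_affine_between {g : V → ℝ} (hg : ConvexOn ℝ Set.univ g) (hgc : Continuous g)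
    {S : Set (V × ℝ)} (hS : Convex ℝ S) (hSne : S.Nonempty) (hSg : ∀ p ∈ S, p.2 ≤ g p.1) :
    ∃ (ℓ : StrongDual ℝ V) (α : ℝ), (∀ v, ℓ v + α ≤ g v) ∧ ∀ p ∈ S, p.2 ≤ ℓ p.1 + α := by
  have hepi : Convex ℝ {p : V × ℝ | g p.1 < p.2} := by
    simpa only [Set.mem_univ, true_and] using hg.convex_strict_epigraph
  have hdisj : Disjoint {p : V × ℝ | g p.1 < p.2} S :=
    Set.disjoint_left.2 fun p hp hpS => (hSg p hpS).not_gt hp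
  obtain ⟨f, u, hfepi, hfS⟩ := geometric_hahn_banach_open hepi
    (isOpen_lt (hgc.comp continuous_fst) continuous_snd) hS hdisj
  set ρ := f (0, 1) with hρ_def
  have hf : ∀ v r, f (v, r) = f (v, 0) + r * ρ := fun v r => by
    rw [hρ_def, ← smul_eq_mul, ← map_smul, ← map_add]
    simp
  have hρ : ρ < 0 := by
    obtain ⟨⟨v, r⟩, hp⟩ := hSne
    have habove := hfepi (v, g v + 1) (lt_add_one (g v))
    have hbelow := hfS _ hp
    have hr : r ≤ g v := hSg _ hp
    rw [hf] at habove hbelow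
    nlinarith
  refine ⟨(-ρ⁻¹) • f.comp (ContinuousLinearMap.inl ℝ V ℝ), u * ρ⁻¹, fun v => ?_, fun p hp => ?_⟩
  · refine le_of_forall_gt_imp_ge_of_dense fun r hr => ?_
    have hlt := hfepi (v, r) hr
    rw [hf] at hlt
    simp only [smul_apply, ContinuousLinearMap.comp_apply, ContinuousLinearMap.inl_apply,
      smul_eq_mul]
    rw [show -ρ⁻¹ * f (v, 0) + u * ρ⁻¹ = (u - f (v, 0)) / ρ by ring, div_le_iff_of_neg hρ]
    linarith
  · have hle := hfS p hp
    rw [← Prod.mk.eta (p := p), hf] at hle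
    simp only [smul_apply, ContinuousLinearMap.comp_apply, ContinuousLinearMap.inl_apply,
      smul_eq_mul]
    rw [show -ρ⁻¹ * f (p.1, 0) + u * ρ⁻¹ = (u - f (p.1, 0)) / ρ by ring, le_div_iff_of_neg hρ]
    linarith

end Separation

variable {n m : ℕ}

theorem continuous_of_convexOn_univ {g : E m → ℝ} (hg : ConvexOn ℝ Set.univ g) : Continuous g :=
  hg.locallyLipschitz.continuous

theorem exists_mem_subdiff_forall_le {g : E m → ℝ} (hg : ConvexOn ℝ Set.univ g)
    {S : Set (E m × ℝ)} (hS : Convex ℝ S) (hSg : ∀ p ∈ S, p.2 ≤ g p.1) {z : E m}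
    (hz : (z, g z) ∈ S) : ∃ y ∈ subdiff g z, ∀ p ∈ S, p.2 ≤ g z + inner ℝ y (p.1 - z) := by
  obtain ⟨ℓ, α, hℓg, hSℓ⟩ :=
    exists_affine_between hg (continuous_of_convexOn_univ hg) hS ⟨_, hz⟩ hSg
  have hα : g z = ℓ z + α := le_antisymm (hSℓ _ hz) (hℓg z)
  have hℓ : ∀ w, g z + inner ℝ ((InnerProductSpace.toDual ℝ (E m)).symm ℓ) (w - z) = ℓ w + α :=
    fun w => by rw [InnerProductSpace.toDual_symm_apply, map_sub, hα]; ring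
  exact ⟨_, fun w => (hℓ w).trans_le (hℓg w), fun p hp => (hSℓ p hp).trans_eq (hℓ p.1).symm⟩

theorem subdiff_nonempty {g : E m → ℝ} (hg : ConvexOn ℝ Set.univ g) (z : E m) :
    (subdiff g z).Nonempty := by
  obtain ⟨y, hy, -⟩ := exists_mem_subdiff_forall_le hg (convex_singleton (z, g z))
    (by rintro p rfl; exact le_rfl) rfl
  exact ⟨y, hy⟩

theorem exists_multiplier {X : Set (E n)} (hX : Convex ℝ X) {g : E m → ℝ}
    (hg : ConvexOn ℝ Set.univ g) (B : E n →L[ℝ] E m) (p : E n) {x : E n} (hx : x ∈ X) (z : E m)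
    (hmin : ∀ x' ∈ X, g z ≤ inner ℝ p (x' - x) + g (z + B (x' - x))) :
    ∃ y ∈ subdiff g z, ∀ x' ∈ X, 0 ≤ inner ℝ p (x' - x) + inner ℝ y (B (x' - x)) := by
  let S : Set (E m × ℝ) := (fun x' => (z + B (x' - x), g z - inner ℝ p (x' - x))) '' X
  have hS : Convex ℝ S := by
    rintro _ ⟨u, hu, rfl⟩ _ ⟨w, hw, rfl⟩ a b ha hb hab
    refine ⟨a • u + b • w, hX hu hw ha hb hab, ?_⟩
    obtain rfl : b = 1 - a := by linarith
    ext1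
    · simp only [Prod.fst_add, Prod.smul_fst, map_sub, map_add, map_smul]
      module
    · simp only [Prod.snd_add, Prod.smul_snd, inner_sub_right, inner_add_right,
        real_inner_smul_right, smul_eq_mul]
      ring
  obtain ⟨y, hy, hle⟩ := exists_mem_subdiff_forall_le hg hS (z := z)
    (by rintro _ ⟨x', hx', rfl⟩; linarith [hmin x' hx']) ⟨x, hx, by simp⟩
  refine ⟨y, hy, fun x' hx' => ?_⟩
  have hx'le := hle _ ⟨x', hx', rfl⟩
  simp only [add_sub_cancel_left] at hx'le
  linarith

theorem inner_sub_nonneg_of_mem_subdiff {g : E m → ℝ} {z z' y y' : E m} (hy : y ∈ subdiff g z)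
    (hy' : y' ∈ subdiff g z') : 0 ≤ inner ℝ (y - y') (z - z') := by
  have hle := hy z'
  have hle' := hy' z
  rw [← neg_sub, inner_neg_right] at hle
  rw [inner_sub_left]
  linarith

theorem mem_subdiff_of_tendsto {ι : Type*} {l : Filter ι} [l.NeBot] {g : E m → ℝ}
    (hg : Continuous g) {y z : ι → E m} {y₀ z₀ : E m} (hy : Tendsto y l (𝓝 y₀))
    (hz : Tendsto z l (𝓝 z₀)) (h : ∀ i, y i ∈ subdiff g (z i)) : y₀ ∈ subdiff g z₀ := fun w =>
  le_of_tendsto (((hg.tendsto _).comp hz).add (hy.inner (tendsto_const_nhds.sub hz)))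
    (Eventually.of_forall fun i => h i w)

theorem mem_normalCone_of_tendsto {ι : Type*} {l : Filter ι} [l.NeBot] {X : Set (E n)}
    (hX : IsClosed X) {v x : ι → E n} {v₀ x₀ : E n} (hv : Tendsto v l (𝓝 v₀))
    (hx : Tendsto x l (𝓝 x₀)) (h : ∀ i, v i ∈ normalCone X (x i)) : v₀ ∈ normalCone X x₀ :=
  ⟨hX.mem_of_tendsto hx (Eventually.of_forall fun i => (h i).1), fun x' hx' =>
    le_of_tendsto (hv.inner (tendsto_const_nhds.sub hx))
      (Eventually.of_forall fun i => (h i).2 x' hx')⟩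

/-! ### Lipschitz convex functions -/

section Lipschitz

variable {V : Type*} [SeminormedAddCommGroup V] [NormedSpace ℝ V]

-- Far out along the ray from `a` through `b`, convexity bounds the slope of `g` by that of `h`.
theorem sub_le_of_convexOn_le_lipschitzWith {g h : V → ℝ} {K : ℝ≥0}
    (hg : ConvexOn ℝ Set.univ g) (hgh : ∀ v, g v ≤ h v) (hh : LipschitzWith K h) (a b : V) :
    g b - g a ≤ K * ‖b - a‖ := by
  have hray : ∀ s : ℝ, 1 ≤ s → g b - g a ≤ (h a - g a) / s + K * ‖b - a‖ := by
    intro s hs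
    have hs0 : 0 < s := by linarith
    have hb : (1 - s⁻¹) • a + s⁻¹ • (a + s • (b - a)) = b := by
      rw [smul_add, smul_smul, inv_mul_cancel₀ hs0.ne']; module
    have hconv := hg.2 (Set.mem_univ a) (Set.mem_univ (a + s • (b - a)))
      (sub_nonneg.2 (inv_le_one_of_one_le₀ hs)) (inv_nonneg.2 hs0.le) (sub_add_cancel _ _)
    rw [hb, smul_eq_mul, smul_eq_mul] at hconv
    have hlip : h (a + s • (b - a)) ≤ h a + K * (s * ‖b - a‖) := by
      have := hh.le_add_mul (a + s • (b - a)) a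
      rwa [dist_eq_norm, add_sub_cancel_left, norm_smul, Real.norm_of_nonneg hs0.le] at this
    calc g b - g a ≤ s⁻¹ * (g (a + s • (b - a)) - g a) := by linarith
      _ ≤ s⁻¹ * (h a + K * (s * ‖b - a‖) - g a) := by
        gcongr
        exact (hgh _).trans hlip
      _ = (h a - g a) / s + K * ‖b - a‖ := by field_simp; ring
  have hlim : Tendsto (fun s : ℝ => (h a - g a) / s + K * ‖b - a‖) atTop
      (𝓝 (0 + K * ‖b - a‖)) :=
    (tendsto_const_nhds.div_atTop tendsto_id).add_const _
  rw [zero_add] at hlim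
  exact ge_of_tendsto hlim (eventually_atTop.2 ⟨1, hray⟩)

theorem lipschitzWith_of_convexOn_le {g h : V → ℝ} {K : ℝ≥0} (hg : ConvexOn ℝ Set.univ g)
    (hgh : ∀ v, g v ≤ h v) (hh : LipschitzWith K h) : LipschitzWith K g :=
  LipschitzWith.of_le_add_mul K fun a b => by
    rw [dist_eq_norm]
    linarith [sub_le_of_convexOn_le_lipschitzWith hg hgh hh b a]

end Lipschitz

theorem IsLowerModel.lipschitzWith {h g : E m → ℝ} (hg : IsLowerModel h g) {K : ℝ≥0}
    (hh : LipschitzWith K h) : LipschitzWith K g :=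
  lipschitzWith_of_convexOn_le hg.1 hg.2 hh

theorem neg_inner_le_mul_norm {V : Type*} [SeminormedAddCommGroup V] [InnerProductSpace ℝ V]
    {g d : V} {M δ : ℝ} (hg : ‖g‖ ≤ M) (hd : ‖d‖ ≤ δ) : -inner ℝ g d ≤ M * δ :=
  (neg_le_abs _).trans ((abs_real_inner_le_norm g d).trans
    (mul_le_mul hg hd (norm_nonneg d) ((norm_nonneg g).trans hg)))

theorem norm_le_of_mem_subdiff {g : E m → ℝ} {K : ℝ≥0} (hg : LipschitzWith K g) {z y : E m}
    (hy : y ∈ subdiff g z) : ‖y‖ ≤ K := by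
  have hsub := hy (z + y)
  have hlip := hg.le_add_mul (z + y) z
  rw [add_sub_cancel_left, real_inner_self_eq_norm_sq] at hsub
  rw [dist_eq_norm, add_sub_cancel_left] at hlip
  by_contra! hlt
  nlinarith [norm_nonneg y]

/-! ### First-order conditions and proximal points -/

theorem le_add_of_isMinOn_add {V : Type*} [NormedAddCommGroup V] [NormedSpace ℝ V]
    {C : Set V} {φ g : V → ℝ} {φ' : V →L[ℝ] ℝ} {x x' : V} (hφ : HasFDerivAt φ φ' x)
    (hg : ConvexOn ℝ C g) (hmin : IsMinOn (fun u => φ u + g u) C x) (hx : x ∈ C) (hx' : x' ∈ C) :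
    g x ≤ φ' (x' - x) + g x' := by
  have hline : HasDerivAt (fun s : ℝ => φ (x + s • (x' - x))) (φ' (x' - x)) 0 := by
    have hray : HasDerivAt (fun s : ℝ => x + s • (x' - x)) (x' - x) 0 := by
      simpa using ((hasDerivAt_id (0 : ℝ)).smul_const (x' - x)).const_add x
    exact HasFDerivAt.comp_hasDerivAt (0 : ℝ) (by simpa using hφ) hray
  suffices hslope : g x - g x' ≤ φ' (x' - x) by linarith
  refine ge_of_tendsto hline.tendsto_slope_zero_right ?_
  filter_upwards [Ioo_mem_nhdsGT (one_pos (α := ℝ))] with s hs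
  have hcomb : (1 - s) • x + s • x' = x + s • (x' - x) := by module
  have hconv := hg.2 hx hx' (sub_nonneg.2 hs.2.le) hs.1.le (sub_add_cancel _ _)
  have hmin_s := isMinOn_iff.1 hmin _ (hg.1.add_smul_sub_mem hx hx' ⟨hs.1.le, hs.2.le⟩)
  rw [hcomb, smul_eq_mul, smul_eq_mul] at hconv
  simp only [zero_add, zero_smul, add_zero, smul_eq_mul]
  rw [le_inv_mul_iff₀ hs.1]
  linarith

theorem gradient_mem_subdiff {f : E n → ℝ} {x : E n} (hf : DifferentiableAt ℝ f x)
    (hconv : ConvexOn ℝ Set.univ f) : gradient f x ∈ subdiff f x := by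
  intro w
  have hmin : IsMinOn (fun u => -f u + f u) Set.univ x := fun u _ => by simp
  have hle := le_add_of_isMinOn_add hf.hasFDerivAt.neg hconv hmin trivial (Set.mem_univ w)
  rw [neg_apply, ← inner_gradient_left] at hle
  linarith

theorem continuous_gradient {f : E n → ℝ} (hf : ContDiff ℝ 1 f) : Continuous (gradient f) :=
  (LinearIsometryEquiv.continuous _).comp (hf.continuous_fderiv one_ne_zero)

theorem hasFDerivAt_prox_term {V : Type*} [NormedAddCommGroup V] [InnerProductSpace ℝ V] (t : ℝ)
    (c x : V) :
    HasFDerivAt (fun u => 1 / (2 * t) * ‖u - c‖ ^ 2) (innerSL ℝ ((1 / t) • (x - c))) x := by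
  refine (((hasFDerivAt_id x).sub_const c).norm_sq.const_mul (1 / (2 * t))).congr_fderiv ?_
  ext v
  simp only [id_eq, ContinuousLinearMap.comp_id, smul_apply, innerSL_apply_apply, nsmul_eq_mul,
    smul_eq_mul, real_inner_smul_left]
  push_cast
  ring

theorem exists_isMinOn_add_prox_term {X : Set (E n)} (hX : IsClosed X) (hXne : X.Nonempty)
    {ψ : E n → ℝ} (hψ : ConvexOn ℝ Set.univ ψ) (c : E n) {t : ℝ} (ht : 0 < t) :
    ∃ x ∈ X, IsMinOn (fun u => 1 / (2 * t) * ‖u - c‖ ^ 2 + ψ u) X x := by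
  obtain ⟨x₀, hx₀⟩ := hXne
  obtain ⟨y, hy⟩ := subdiff_nonempty hψ c
  have hlower : ∀ u, (1 / (2 * t) * dist u c + -‖y‖) * dist u c + ψ c
      ≤ 1 / (2 * t) * ‖u - c‖ ^ 2 + ψ u := fun u => by
    rw [dist_eq_norm]
    nlinarith [hy u, neg_le_of_abs_le (abs_real_inner_le_norm y (u - c))]
  have hcoercive : Tendsto (fun u => 1 / (2 * t) * ‖u - c‖ ^ 2 + ψ u) (cocompact (E n)) atTop := by
    have hdist : Tendsto (fun u => dist u c) (cocompact (E n)) atTop :=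
      tendsto_dist_right_cocompact_atTop c
    have hslope : Tendsto (fun u => 1 / (2 * t) * dist u c + -‖y‖) (cocompact (E n)) atTop :=
      tendsto_atTop_add_const_right _ _ (hdist.const_mul_atTop (by positivity))
    exact tendsto_atTop_mono hlower
      (tendsto_atTop_add_const_right _ _ (hslope.atTop_mul_atTop₀ hdist))
  have hcont : Continuous fun u => 1 / (2 * t) * ‖u - c‖ ^ 2 + ψ u := by
    have := continuous_of_convexOn_univ hψ
    fun_prop
  exact hcont.continuousOn.exists_isMinOn' hX hx₀
    ((hcoercive.eventually_ge_atTop _).filter_mono inf_le_left)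

theorem exists_master_solution {X : Set (E n)} (hXne : X.Nonempty) (hXc : IsClosed X)
    (hX : Convex ℝ X) {f : E n → ℝ} (hf : Differentiable ℝ f) (hfconv : ConvexOn ℝ Set.univ f)
    {g : E m → ℝ} (hg : ConvexOn ℝ Set.univ g) (B : E n →L[ℝ] E m) (b : E m) (c : E n) {t : ℝ}
    (ht : 0 < t) :
    ∃ (x : E n) (y : E m), y ∈ subdiff g (b + B (x - c)) ∧
      -gradient f x - ContinuousLinearMap.adjoint B y - (1 / t) • (x - c) ∈ normalCone X x := by
  have hgB : ConvexOn ℝ Set.univ fun u => g (b + B (u - c)) := by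
    have := (hg.translate_right (b - B c)).comp_linearMap (B : E n →ₗ[ℝ] E m)
    refine this.congr fun u _ => ?_
    simp only [Function.comp_apply, ContinuousLinearMap.coe_coe, map_sub]
    congr 1
    abel
  obtain ⟨x, hx, hmin⟩ := exists_isMinOn_add_prox_term hXc hXne (hfconv.add hgB) c ht
  have hder := (hf x).hasFDerivAt.add (hasFDerivAt_prox_term t c x)
  have hfirst : ∀ x' ∈ X, g (b + B (x - c)) ≤ inner ℝ (gradient f x + (1 / t) • (x - c)) (x' - x)
      + g (b + B (x - c) + B (x' - x)) := fun x' hx' => by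
    have hle := le_add_of_isMinOn_add hder (hgB.subset (Set.subset_univ X) hX)
      (isMinOn_iff.2 fun u hu => by
        have := isMinOn_iff.1 hmin u hu
        simp only [Pi.add_apply] at this ⊢
        linarith) hx hx'
    rwa [add_apply, innerSL_apply_apply, ← inner_gradient_left, ← inner_add_left,
      show x' - c = (x - c) + (x' - x) by abel, map_add, ← add_assoc] at hle
  obtain ⟨y, hy, hyX⟩ := exists_multiplier hX hg B _ hx _ hfirst
  refine ⟨x, y, hy, hx, fun x' hx' => ?_⟩
  have hle := hyX x' hx'
  rw [inner_add_left] at hle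
  rw [inner_sub_left, inner_sub_left, inner_neg_left, ContinuousLinearMap.adjoint_inner_left]
  linarith

theorem exists_sub_mem_subdiff {g : E m → ℝ} (hg : ConvexOn ℝ Set.univ g) (w : E m) :
    ∃ z, w - z ∈ subdiff g z := by
  obtain ⟨z, -, hmin⟩ :=
    exists_isMinOn_add_prox_term isClosed_univ Set.univ_nonempty hg w one_pos
  refine ⟨z, fun z' => ?_⟩
  have hle := le_add_of_isMinOn_add (hasFDerivAt_prox_term 1 w z) hg hmin (Set.mem_univ z)
    (Set.mem_univ z')
  rw [innerSL_apply_apply, div_one, one_smul, ← neg_sub w z, inner_neg_left] at hle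
  linarith

-- Brøndsted–Rockafellar: the perturbed subgradient is found at the proximal point of `c + y`.
theorem exists_mem_subdiff_near {g : E m → ℝ} (hg : ConvexOn ℝ Set.univ g) {c y : E m} {ε : ℝ}
    (hy : ∀ w, g c + inner ℝ y (w - c) - ε ≤ g w) :
    ∃ z, ∃ y' ∈ subdiff g z, ‖z - c‖ ^ 2 ≤ ε ∧ ‖y' - y‖ ^ 2 ≤ ε := by
  obtain ⟨z, hz⟩ := exists_sub_mem_subdiff hg (c + y)
  have hdiff : c + y - z - y = -(z - c) := by abel
  have hdist : ‖z - c‖ ^ 2 ≤ ε := by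
    have hle := hz c
    have hsplit : c + y - z = y - (z - c) := by abel
    rw [hsplit, ← neg_sub z c, inner_neg_right, inner_sub_left, real_inner_self_eq_norm_sq] at hle
    linarith [hy z]
  exact ⟨z, _, hz, hdist, by rwa [hdiff, norm_neg]⟩

/-! ### Smoothness of the problem data -/

theorem norm_sub_linearization_le {V W : Type*} [NormedAddCommGroup V] [NormedSpace ℝ V]
    [NormedAddCommGroup W] [NormedSpace ℝ W] {f : V → W} {C : Set V} (hC : Convex ℝ C)
    (hf : ∀ x ∈ C, DifferentiableAt ℝ f x) {K : ℝ≥0} (hK : LipschitzOnWith K (fderiv ℝ f) C)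
    {x x' : V} (hx : x ∈ C) (hx' : x' ∈ C) :
    ‖f x' - (f x + fderiv ℝ f x (x' - x))‖ ≤ K * ‖x' - x‖ ^ 2 := by
  have hsub : segment ℝ x x' ⊆ C := hC.segment_subset hx hx'
  have hderiv : ∀ u ∈ segment ℝ x x', ‖fderiv ℝ f u - fderiv ℝ f x‖ ≤ K * ‖x' - x‖ := by
    intro u hu
    rw [← dist_eq_norm, ← dist_eq_norm]
    refine (hK.dist_le_mul u (hsub hu) x hx).trans ?_
    gcongr
    linarith [dist_add_dist_of_mem_segment hu, dist_comm u x, dist_comm x x',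
      dist_nonneg (x := u) (y := x')]
  have hmvt := (convex_segment (𝕜 := ℝ) x x').norm_image_sub_le_of_norm_fderiv_le'
    (fun u hu => hf u (hsub hu)) hderiv (left_mem_segment ℝ x x') (right_mem_segment ℝ x x')
  rwa [← sub_sub, pow_two, ← mul_assoc]

variable {P : Problem n m} {A : Params n}

namespace Problem.Assumptions

theorem contDiff_F (hP : P.Assumptions) : ContDiff ℝ 1 P.F := contDiff_euclidean.2 hP.smooth_F

theorem differentiable_F (hP : P.Assumptions) : Differentiable ℝ P.F :=
  hP.contDiff_F.differentiable one_ne_zero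

theorem differentiable_f₀ (hP : P.Assumptions) : Differentiable ℝ P.f₀ :=
  hP.smooth_f₀.differentiable one_ne_zero

theorem continuous_fderiv_F (hP : P.Assumptions) : Continuous (fderiv ℝ P.F) :=
  hP.contDiff_F.continuous_fderiv one_ne_zero

theorem fderiv_F_apply (hP : P.Assumptions) (x v : E n) (i : Fin m) :
    fderiv ℝ P.F x v i = inner ℝ (gradient (P.comp i) x) v := by
  have hcomp : HasFDerivAt (P.comp i) ((EuclideanSpace.proj (𝕜 := ℝ) i).comp (fderiv ℝ P.F x)) x :=
    (EuclideanSpace.proj (𝕜 := ℝ) i).hasFDerivAt.comp x (hP.differentiable_F x).hasFDerivAt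
  rw [inner_gradient_left, hcomp.fderiv]
  rfl

theorem adjoint_fderiv_F (hP : P.Assumptions) (x : E n) (y : E m) :
    ContinuousLinearMap.adjoint (fderiv ℝ P.F x) y = ∑ i, y i • gradient (P.comp i) x := by
  refine ext_inner_right ℝ fun v => ?_
  rw [ContinuousLinearMap.adjoint_inner_left, PiLp.inner_apply, sum_inner]
  refine Finset.sum_congr rfl fun i _ => ?_
  rw [hP.fderiv_F_apply, real_inner_smul_left]
  simp [mul_comm]

theorem exists_lipschitzOnWith_fderiv_F (hP : P.Assumptions) :
    ∃ K : ℝ≥0, LipschitzOnWith K (fderiv ℝ P.F) P.X := by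
  choose L hL0 hL using hP.lipschitz_grad
  refine ⟨∑ i, (1 / 2 * L i).toNNReal, LipschitzOnWith.of_dist_le_mul fun x hx x' hx' => ?_⟩
  have hcoe : ∀ i, ((1 / 2 * L i).toNNReal : ℝ) = 1 / 2 * L i :=
    fun i => Real.coe_toNNReal _ (by linarith [hL0 i])
  rw [dist_eq_norm, dist_eq_norm, ← LinearIsometryEquiv.norm_map ContinuousLinearMap.adjoint,
    map_sub, NNReal.coe_sum]
  refine ContinuousLinearMap.opNorm_le_bound _ (by positivity) fun y => ?_
  rw [sub_apply, hP.adjoint_fderiv_F, hP.adjoint_fderiv_F,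
    ← Finset.sum_sub_distrib, Finset.sum_mul, Finset.sum_mul]
  refine norm_sum_le_of_le _ fun i _ => ?_
  rw [← smul_sub, norm_smul, hcoe, mul_comm]
  exact mul_le_mul (hL i x hx x' hx') (PiLp.norm_apply_le y i) (norm_nonneg _)
    (by have := hL0 i; positivity)

theorem exists_lipschitzWith_h (hP : P.Assumptions) : ∃ K : ℝ≥0, LipschitzWith K P.h := by
  obtain ⟨L, hL0, hL⟩ := hP.lipschitz_h
  refine ⟨⟨L, hL0.le⟩, LipschitzWith.of_dist_le_mul fun z z' => ?_⟩
  rw [Real.dist_eq, dist_eq_norm]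
  exact hL z z'

theorem continuous_h (hP : P.Assumptions) : Continuous P.h :=
  continuous_of_convexOn_univ hP.convex_h

theorem continuous_obj (hP : P.Assumptions) : Continuous P.obj :=
  hP.smooth_f₀.continuous.add (hP.continuous_h.comp hP.contDiff_F.continuous)

theorem isCompact_level (hP : P.Assumptions) {x₀ : E n} (hlev : P.LevelBounded x₀) :
    IsCompact {x | x ∈ P.X ∧ P.obj x ≤ P.obj x₀} :=
  Metric.isCompact_of_isClosed_isBounded
    (hP.closed_X.inter (isClosed_le hP.continuous_obj continuous_const)) hlev

theorem isLowerModel_h (hP : P.Assumptions) : IsLowerModel P.h P.h :=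
  ⟨hP.convex_h, fun _ => le_rfl⟩

end Problem.Assumptions

/-! ### One iteration -/

section Iteration

variable {s s' : State n m} {T T' : Trial n m}

namespace IsTrial

theorem linearization_sub_z (hT : IsTrial P s T) (x : E n) :
    P.F s.center + fderiv ℝ P.F s.center (x - s.center) - T.z
      = fderiv ℝ P.F s.center (x - T.x) := by
  rw [hT.z_eq, add_sub_add_left_eq_sub, ← map_sub, sub_sub_sub_cancel_right]

-- The master objective with the model replaced by its linearization at `T.z` is still minimized by
-- `T.x` over `X`, and it is `1 / t`-strongly convex.
theorem growth (hP : P.Assumptions) (hT : IsTrial P s T) {x : E n} (hx : x ∈ P.X) :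
    P.f₀ T.x + 1 / (2 * s.t) * ‖T.x - s.center‖ ^ 2 + 1 / (2 * s.t) * ‖x - T.x‖ ^ 2 ≤
      P.f₀ x + inner ℝ T.y (P.F s.center + fderiv ℝ P.F s.center (x - s.center) - T.z)
        + 1 / (2 * s.t) * ‖x - s.center‖ ^ 2 := by
  have hf₀ := gradient_mem_subdiff (hP.differentiable_f₀ T.x) hP.convex_f₀ x
  have hopt := hT.x_opt.2 x hx
  rw [inner_sub_left, inner_sub_left, inner_neg_left, ContinuousLinearMap.adjoint_inner_left,
    real_inner_smul_left] at hopt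
  have hnorm : ‖x - s.center‖ ^ 2 = ‖T.x - s.center‖ ^ 2 + 2 * inner ℝ (T.x - s.center) (x - T.x)
      + ‖x - T.x‖ ^ 2 := by
    rw [← norm_add_sq_real, add_comm, sub_add_sub_cancel]
  have hprox : 1 / (2 * s.t) * ‖x - s.center‖ ^ 2 = 1 / (2 * s.t) * ‖T.x - s.center‖ ^ 2
      + 1 / s.t * inner ℝ (T.x - s.center) (x - T.x) + 1 / (2 * s.t) * ‖x - T.x‖ ^ 2 := by
    rw [hnorm]; ring
  rw [hT.linearization_sub_z]
  linarith

theorem x_eq (hP : P.Assumptions) (ht : 0 < s.t) (hT : IsTrial P s T) (hT' : IsTrial P s T') :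
    T'.x = T.x := by
  have hgrowth := hT.growth hP hT'.x_opt.1
  have hgrowth' := hT'.growth hP hT.x_opt.1
  rw [← hT'.z_eq, ← neg_sub T.z, inner_neg_right] at hgrowth
  rw [← hT.z_eq, norm_sub_rev T.x T'.x] at hgrowth'
  have hmono := inner_sub_nonneg_of_mem_subdiff hT.y_mem hT'.y_mem
  rw [inner_sub_left] at hmono
  have hle : 1 / (2 * s.t) * ‖T'.x - T.x‖ ^ 2 ≤ 0 := by linarith
  have hsq : ‖T'.x - T.x‖ ^ 2 ≤ 0 := nonpos_of_mul_nonpos_right hle (by positivity)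
  exact sub_eq_zero.1 (norm_eq_zero.1 (pow_eq_zero_iff two_ne_zero |>.1
    (hsq.antisymm (sq_nonneg _))))

theorem z_eq_of_x_eq (hT : IsTrial P s T) (hT' : IsTrial P s T') (hx : T'.x = T.x) :
    T'.z = T.z := by
  rw [hT.z_eq, hT'.z_eq, hx]

theorem le_predDecrease (hP : P.Assumptions) (hc : s.center ∈ P.X) (hT : IsTrial P s T) :
    P.h (P.F s.center) - s.model T.z - inner ℝ T.y (P.F s.center - T.z)
      + 1 / s.t * ‖T.x - s.center‖ ^ 2 ≤ predDecrease P s T := by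
  have hgrowth := hT.growth hP hc
  rw [sub_self, map_zero, add_zero, norm_zero, norm_sub_rev s.center] at hgrowth
  have htwo : 1 / s.t * ‖T.x - s.center‖ ^ 2 = 1 / (2 * s.t) * ‖T.x - s.center‖ ^ 2
    + 1 / (2 * s.t) * ‖T.x - s.center‖ ^ 2 := by ring
  unfold predDecrease
  linarith

theorem linearization_gap_nonneg (hs : IsLowerModel P.h s.model) (hT : IsTrial P s T) :
    0 ≤ P.h (P.F s.center) - s.model T.z - inner ℝ T.y (P.F s.center - T.z) := by
  linarith [hT.y_mem (P.F s.center), hs.2 (P.F s.center)]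

end IsTrial

/-- The invariant of the algorithm: what holds of every state it reaches, apart from the positive
lower bound on the prox-parameters (`Constants.Valid`). -/
structure State.Admissible (P : Problem n m) (A : Params n) (s : State n m) : Prop where
  center_mem : s.center ∈ P.X
  obj_le : P.obj s.center ≤ P.obj A.x₀
  tlow_pos : 0 < s.tlow
  tlow_le : s.tlow ≤ s.t
  t_le : s.t ≤ A.tmax
  lower : IsLowerModel P.h s.model
  slope_mem : s.slope ∈ subdiff P.h (P.F s.center)

namespace State.Admissible

theorem t_pos (hs : s.Admissible P A) : 0 < s.t := hs.tlow_pos.trans_le hs.tlow_le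

theorem norm_sq_le (hP : P.Assumptions) (hs : s.Admissible P A) (hT : IsTrial P s T) :
    1 / s.t * ‖T.x - s.center‖ ^ 2 ≤ predDecrease P s T := by
  linarith [hT.le_predDecrease hP hs.center_mem, hT.linearization_gap_nonneg hs.lower]

theorem predDecrease_nonneg (hP : P.Assumptions) (hs : s.Admissible P A) (hT : IsTrial P s T) :
    0 ≤ predDecrease P s T :=
  le_trans (mul_nonneg (one_div_pos.2 hs.t_pos).le (sq_nonneg _)) (hs.norm_sq_le hP hT)

theorem serious (hP : P.Assumptions) (hA : A.Valid P) (hs : s.Admissible P A) (hT : IsTrial P s T)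
    (h₂ : Test₂ P A s T) (hstep : SeriousStep P A s T s') : s'.Admissible P A where
  center_mem := hstep.center_eq ▸ hT.x_opt.1
  obj_le := by
    have hdecrease : P.obj T.x ≤ P.obj s.center - A.κ / 2 * predDecrease P s T := h₂
    rw [hstep.center_eq]
    linarith [hs.obj_le, mul_nonneg (half_pos hA.κ_pos).le (hs.predDecrease_nonneg hP hT)]
  tlow_pos := hstep.tlow_eq ▸ hs.tlow_pos
  tlow_le := hstep.tlow_eq ▸ hs.tlow_le.trans hstep.t_mem.1
  t_le := hstep.t_mem.2
  lower := hstep.lower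
  slope_mem := hstep.slope_mem

theorem backtracking (hA : A.Valid P) (hs : s.Admissible P A)
    (hstep : BacktrackingStep P A s T s') : s'.Admissible P A where
  center_mem := hstep.center_eq ▸ hs.center_mem
  obj_le := hstep.center_eq ▸ hs.obj_le
  tlow_pos := hstep.tlow_eq ▸
    lt_min (div_pos hs.t_pos (one_pos.trans hA.one_lt_τ)) hs.tlow_pos
  tlow_le := by rw [hstep.tlow_eq, hstep.t_eq]; exact min_le_left _ _
  t_le := hstep.t_eq ▸ (div_le_self hs.t_pos.le hA.one_lt_τ.le).trans hs.t_le
  lower := hstep.model.1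
  slope_mem := by rw [hstep.center_eq, hstep.slope_eq]; exact hs.slope_mem

theorem null (hs : s.Admissible P A) (hstep : NullStep P s T s') : s'.Admissible P A where
  center_mem := hstep.center_eq ▸ hs.center_mem
  obj_le := hstep.center_eq ▸ hs.obj_le
  tlow_pos := hstep.tlow_eq ▸ hs.tlow_pos
  tlow_le := hstep.tlow_eq ▸ hstep.t_mem.1
  t_le := hstep.t_mem.2.trans hs.t_le
  lower := hstep.model.1
  slope_mem := by rw [hstep.center_eq, hstep.slope_eq]; exact hs.slope_mem

end State.Admissible

theorem update_iff :
    Update P A s T s' ↔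
      (Test₁ P A s T ∧ Test₂ P A s T ∧ SeriousStep P A s T s') ∨
      (Test₁ P A s T ∧ ¬ Test₂ P A s T ∧ BacktrackingStep P A s T s') ∨
      (¬ Test₁ P A s T ∧ NullStep P s T s') := by
  unfold Update
  tauto

namespace State.Admissible

theorem update (hP : P.Assumptions) (hA : A.Valid P) (hs : s.Admissible P A) (hT : IsTrial P s T)
    (hU : Update P A s T s') : s'.Admissible P A := by
  rcases update_iff.1 hU with ⟨-, h₂, hstep⟩ | ⟨-, -, hstep⟩ | ⟨-, hstep⟩
  · exact hs.serious hP hA hT h₂ hstep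
  · exact hs.backtracking hA hstep
  · exact hs.null hstep

theorem exists_trial (hP : P.Assumptions) (hs : s.Admissible P A) : ∃ T, IsTrial P s T := by
  obtain ⟨x, y, hy, hx⟩ := exists_master_solution hP.nonempty_X hP.closed_X hP.convex_X
    hP.differentiable_f₀ hP.convex_f₀ hs.lower.1 (fderiv ℝ P.F s.center) (P.F s.center) s.center
    hs.t_pos
  exact ⟨⟨x, y, _⟩, rfl, hy, hx⟩

theorem modelUpdate_h (hP : P.Assumptions) (hs : s.Admissible P A) (hT : IsTrial P s T)
    (hs' : s'.model = P.h) : ModelUpdate P s T s' := by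
  obtain ⟨g, hg⟩ := subdiff_nonempty hP.convex_h T.z
  unfold ModelUpdate
  rw [hs']
  exact ⟨hP.isLowerModel_h, hs.slope_mem, ⟨g, hg, hg⟩,
    fun z => (hT.y_mem z).trans (hs.lower.2 z)⟩

theorem exists_update (hP : P.Assumptions) (hs : s.Admissible P A) (hT : IsTrial P s T) :
    ∃ s', Update P A s T s' := by
  simp only [update_iff]
  by_cases h₁ : Test₁ P A s T
  · by_cases h₂ : Test₂ P A s T
    · obtain ⟨g, hg⟩ := subdiff_nonempty hP.convex_h (P.F T.x)
      exact ⟨⟨T.x, g, s.t, s.tlow, P.h⟩,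
        .inl ⟨h₁, h₂, rfl, ⟨le_rfl, hs.t_le⟩, rfl, hg, hP.isLowerModel_h, hg⟩⟩
    · exact ⟨⟨s.center, s.slope, s.t / A.τ, min (s.t / A.τ) s.tlow, P.h⟩,
        .inr (.inl ⟨h₁, h₂, rfl, rfl, rfl, rfl, hs.modelUpdate_h hP hT rfl⟩)⟩
  · exact ⟨⟨s.center, s.slope, s.t, s.tlow, P.h⟩,
      .inr (.inr ⟨h₁, rfl, rfl, ⟨hs.tlow_le, le_rfl⟩, rfl, hs.modelUpdate_h hP hT rfl⟩)⟩

end State.Admissible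

theorem IsInit.admissible (hA : A.Valid P) (hs : IsInit P A s) : s.Admissible P A where
  center_mem := hs.center_eq ▸ hA.x₀_mem
  obj_le := by rw [hs.center_eq]
  tlow_pos := hs.tlow_eq ▸ hA.tlow_pos
  tlow_le := by rw [hs.tlow_eq, hs.t_eq]; exact hA.tlow_lt.le
  t_le := hs.t_eq ▸ hA.t₀_lt.le
  lower := hs.lower
  slope_mem := hs.slope_mem

theorem exists_isInit (hP : P.Assumptions) : ∃ s : State n m, IsInit P A s := by
  obtain ⟨g, hg⟩ := subdiff_nonempty hP.convex_h (P.F A.x₀)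
  exact ⟨⟨A.x₀, g, A.t₀, A.tlow, P.h⟩, rfl, hg, rfl, rfl, hP.isLowerModel_h⟩

end Iteration

/-! ### Executions exist -/

section Execution

variable {Tol : ℝ} {r : Run n m} {K : ℕ}

theorem Run.IsPartial.admissible (hP : P.Assumptions) (hA : A.Valid P)
    (hr : r.IsPartial P A Tol K) (hact : r.Active P Tol K) : (r.state K).Admissible P A := by
  induction K with
  | zero => exact hr.1.admissible hA
  | succ k ih =>
    have hact' : r.Active P Tol k := fun j hj => hact j (hj.trans k.lt_succ_self)
    obtain ⟨hT, hU⟩ := hr.2 k k.lt_succ_self hact'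
    exact (ih ⟨hr.1, fun j hj => hr.2 j (hj.trans k.lt_succ_self)⟩ hact').update hP hA hT
      (hU (hact k k.lt_succ_self))

theorem Run.IsExecution.isPartial (hr : r.IsExecution P A Tol) : r.IsPartial P A Tol K :=
  ⟨hr.1, fun k _ => hr.2 k⟩

instance : Nonempty (State n m) := ⟨⟨0, 0, 0, 0, 0⟩⟩

instance : Nonempty (Trial n m) := ⟨⟨0, 0, 0⟩⟩

namespace Run

/-- The states of `Run.extend`. -/
noncomputable def extendState (P : Problem n m) (A : Params n) (K : ℕ) (r : Run n m) :
    ℕ → State n m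
  | 0 => r.state 0
  | k + 1 =>
    if k + 1 ≤ K then r.state (k + 1)
    else Classical.epsilon (Update P A (extendState P A K r k)
      (Classical.epsilon (IsTrial P (extendState P A K r k))))

/-- The continuation of the partial execution recorded by `r` after its first `K` iterations, all
choices of the algorithm being made by `Classical.epsilon`. -/
noncomputable def extend (P : Problem n m) (A : Params n) (K : ℕ) (r : Run n m) : Run n m where
  state := extendState P A K r
  trial k := if k < K then r.trial k else Classical.epsilon (IsTrial P (extendState P A K r k))

theorem extend_state_of_le {k : ℕ} (hk : k ≤ K) : (r.extend P A K).state k = r.state k := by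
  cases k with
  | zero => rfl
  | succ k => exact if_pos hk

theorem extend_trial_of_lt {k : ℕ} (hk : k < K) : (r.extend P A K).trial k = r.trial k :=
  if_pos hk

theorem extend_trial_of_le {k : ℕ} (hk : K ≤ k) :
    (r.extend P A K).trial k = Classical.epsilon (IsTrial P ((r.extend P A K).state k)) :=
  if_neg hk.not_gt

theorem extend_state_succ {k : ℕ} (hk : K ≤ k) :
    (r.extend P A K).state (k + 1) =
      Classical.epsilon (Update P A ((r.extend P A K).state k) ((r.extend P A K).trial k)) := by
  rw [extend_trial_of_le hk]
  exact if_neg (by omega)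

theorem extend_v_of_lt {k : ℕ} (hk : k < K) : (r.extend P A K).v P k = r.v P k := by
  unfold v
  rw [extend_state_of_le hk.le, extend_trial_of_lt hk]

theorem IsPartial.extend_obeys_of_lt (hr : r.IsPartial P A Tol K) {k : ℕ} (hk : k < K) :
    (r.extend P A K).Obeys P A Tol k := by
  intro hact
  rw [extend_state_of_le hk.le, extend_trial_of_lt hk, extend_state_of_le hk, extend_v_of_lt hk]
  exact hr.2 k hk fun j hj => extend_v_of_lt (hj.trans hk) ▸ hact j hj

theorem IsPartial.isExecution_extend (hP : P.Assumptions) (hA : A.Valid P)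
    (hr : r.IsPartial P A Tol K) : (r.extend P A K).IsExecution P A Tol := by
  refine ⟨hr.1, fun k => ?_⟩
  induction k using Nat.strong_induction_on with
  | _ k ih =>
    rcases lt_or_ge k K with hk | hk
    · exact hr.extend_obeys_of_lt hk
    · intro hact
      have hpartial : (r.extend P A K).IsPartial P A Tol k := ⟨hr.1, ih⟩
      have hs := hpartial.admissible hP hA hact
      have hT : IsTrial P ((r.extend P A K).state k) ((r.extend P A K).trial k) :=
        extend_trial_of_le hk ▸ Classical.epsilon_spec (hs.exists_trial hP)
      exact ⟨hT, fun _ => extend_state_succ hk ▸ Classical.epsilon_spec (hs.exists_update hP hT)⟩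

end Run

theorem wellDefined (hP : P.Assumptions) (hA : A.Valid P) : WellDefined P A Tol := by
  refine ⟨exists_isInit hP, fun r hr k hk T hT => ?_, fun K r hr => ⟨r.extend P A K,
    hr.isExecution_extend hP hA, fun _ => Run.extend_state_of_le, fun _ => Run.extend_trial_of_lt⟩⟩
  have hT' := (hr.2 k hk).1
  have hx := hT'.x_eq hP (hr.isPartial.admissible hP hA hk).t_pos hT
  exact ⟨hx, hT'.z_eq_of_x_eq hT hx⟩

end Execution

/-! ### A positive lower bound on the prox-parameters -/

variable {s s' : State n m} {T : Trial n m}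

theorem Params.Valid.tmax_pos (hA : A.Valid P) : 0 < A.tmax :=
  hA.tlow_pos.trans (hA.tlow_lt.trans hA.t₀_lt)

/-- Constants on which the rate at which the algorithm approaches stationarity depends. -/
structure Constants where
  Lh : ℝ≥0
  LF : ℝ≥0
  G : ℝ≥0
  tmin : ℝ

/-- `Lh` and `LF` are Lipschitz constants of `h` and of the derivative of `F` on `X`, `G` bounds
this derivative on the initial level set, and `tmin` is so small that no backtracking step goes
below it. -/
structure Constants.Valid (c : Constants) (P : Problem n m) (A : Params n) : Prop where
  lipschitz_h : LipschitzWith c.Lh P.h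
  lipschitz_fderiv_F : LipschitzOnWith c.LF (fderiv ℝ P.F) P.X
  norm_fderiv_F_le : ∀ x ∈ P.X, P.obj x ≤ P.obj A.x₀ → ‖fderiv ℝ P.F x‖ ≤ c.G
  tmin_pos : 0 < c.tmin
  tmin_le : c.tmin ≤ A.tlow
  tmin_mul_le : c.tmin * A.τ * (2 * c.Lh * c.LF) ≤ A.κ

theorem Constants.exists_valid (hP : P.Assumptions) (hA : A.Valid P)
    (hlev : P.LevelBounded A.x₀) : ∃ c : Constants, c.Valid P A := by
  obtain ⟨Lh, hLh⟩ := hP.exists_lipschitzWith_h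
  obtain ⟨LF, hLF⟩ := hP.exists_lipschitzOnWith_fderiv_F
  obtain ⟨G, hG⟩ := (hP.isCompact_level hlev).exists_bound_of_continuousOn
    hP.continuous_fderiv_F.continuousOn
  have hτ : 0 < A.τ := one_pos.trans hA.one_lt_τ
  have hden : 0 < A.τ * (2 * Lh * LF) + 1 := by positivity
  have hκ : 0 < A.κ / (A.τ * (2 * Lh * LF) + 1) := div_pos hA.κ_pos hden
  set tmin := min A.tlow (A.κ / (A.τ * (2 * Lh * LF) + 1))
  have htmin : 0 < tmin := lt_min hA.tlow_pos hκ
  refine ⟨⟨Lh, LF, G.toNNReal, tmin⟩, hLh, hLF,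
    fun x hx hobj => (hG x ⟨hx, hobj⟩).trans (Real.le_coe_toNNReal G), htmin, min_le_left _ _, ?_⟩
  calc tmin * A.τ * (2 * Lh * LF) ≤ tmin * (A.τ * (2 * Lh * LF) + 1) := by linarith
    _ ≤ A.κ := (le_div_iff₀ hden).1 (min_le_right _ _)

variable {c : Constants}

namespace Constants.Valid

-- The second test can fail after the first has succeeded only through the linearization error,
-- which is at most `Lh * LF * ‖T.x - s.center‖ ^ 2`.
theorem tmin_le_div_of_backtracking (hc : c.Valid P A) (hP : P.Assumptions) (hA : A.Valid P)
    (hs : s.Admissible P A) (hT : IsTrial P s T) (h₁ : Test₁ P A s T) (h₂ : ¬ Test₂ P A s T) :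
    c.tmin ≤ s.t / A.τ := by
  have ht := hs.t_pos
  set d := ‖T.x - s.center‖ ^ 2
  have hlip : P.h (P.F T.x) ≤ P.h T.z + c.Lh * (c.LF * d) := by
    have herr := norm_sub_linearization_le hP.convex_X (fun x _ => hP.differentiable_F x)
      hc.lipschitz_fderiv_F hs.center_mem hT.x_opt.1
    rw [← hT.z_eq, ← dist_eq_norm] at herr
    exact (hc.lipschitz_h.le_add_mul _ _).trans (by gcongr)
  have hdecrease : A.κ * (1 / s.t * d) ≤ A.κ * predDecrease P s T :=
    mul_le_mul_of_nonneg_left (hs.norm_sq_le hP hT) hA.κ_pos.le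
  have hκd : A.κ * (1 / s.t * d) < 2 * c.Lh * c.LF * d := by
    unfold Test₁ at h₁
    unfold Test₂ at h₂
    linarith
  have hκ : A.κ < s.t * (2 * c.Lh * c.LF) := by
    refine lt_of_mul_lt_mul_right (a := d) ?_ (sq_nonneg _)
    calc A.κ * d = s.t * (A.κ * (1 / s.t * d)) := by field_simp
      _ < s.t * (2 * c.Lh * c.LF * d) := mul_lt_mul_of_pos_left hκd ht
      _ = s.t * (2 * c.Lh * c.LF) * d := by ring
  rw [le_div_iff₀ (one_pos.trans hA.one_lt_τ)]
  exact (lt_of_mul_lt_mul_right (hc.tmin_mul_le.trans_lt hκ) (by positivity)).le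

theorem tmin_le_tlow_of_update (hc : c.Valid P A) (hP : P.Assumptions) (hA : A.Valid P)
    (hs : s.Admissible P A) (htmin : c.tmin ≤ s.tlow) (hT : IsTrial P s T)
    (hU : Update P A s T s') : c.tmin ≤ s'.tlow := by
  rcases update_iff.1 hU with ⟨-, -, hstep⟩ | ⟨h₁, h₂, hstep⟩ | ⟨-, hstep⟩
  · exact hstep.tlow_eq ▸ htmin
  · exact hstep.tlow_eq ▸ le_min (hc.tmin_le_div_of_backtracking hP hA hs hT h₁ h₂) htmin
  · exact hstep.tlow_eq ▸ htmin

end Constants.Valid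

theorem Run.IsPartial.tmin_le_tlow {Tol : ℝ} {r : Run n m} {K : ℕ} (hP : P.Assumptions)
    (hA : A.Valid P) (hc : c.Valid P A) (hr : r.IsPartial P A Tol K) (hact : r.Active P Tol K) :
    c.tmin ≤ (r.state K).tlow := by
  induction K with
  | zero => exact hr.1.tlow_eq ▸ hc.tmin_le
  | succ k ih =>
    have hact' : r.Active P Tol k := fun j hj => hact j (hj.trans k.lt_succ_self)
    have hr' : r.IsPartial P A Tol k := ⟨hr.1, fun j hj => hr.2 j (hj.trans k.lt_succ_self)⟩
    obtain ⟨hT, hU⟩ := hr.2 k k.lt_succ_self hact'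
    exact hc.tmin_le_tlow_of_update hP hA (hr'.admissible hP hA hact') (ih hr' hact') hT
      (hU (hact k k.lt_succ_self))

/-! ### Approximate stationarity -/

/-- `x` is stationary up to an error of `ε`: some element of `S(x, y, z)` whose second component
vanishes has its other two components `F(x) - z` and `u` of total norm at most `ε`. -/
def ApproxStationary (P : Problem n m) (ε : ℝ) (x : E n) : Prop :=
  ∃ (y z : E m) (u : E n), y ∈ subdiff P.h z ∧ ‖P.F x - z‖ + ‖u‖ ≤ ε ∧
    u - gradient P.f₀ x - ContinuousLinearMap.adjoint (fderiv ℝ P.F x) y ∈ normalCone P.X x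

theorem Problem.Assumptions.mem_S (hP : P.Assumptions) {x : E n} {y z : E m}
    {w : WithLp 2 (E m × WithLp 2 (E m × E n))} (hF : w.fst = P.F x - z)
    (hh : w.snd.fst + y ∈ subdiff P.h z)
    (hX : w.snd.snd - gradient P.f₀ x - ContinuousLinearMap.adjoint (fderiv ℝ P.F x) y
      ∈ normalCone P.X x) : w ∈ P.S x y z := by
  refine ⟨hF, Set.mem_sub.2 ⟨_, hh, y, rfl, by abel⟩, ?_⟩
  have hD : ∑ i, y i • convexHull ℝ (P.D i x)
      = {ContinuousLinearMap.adjoint (fderiv ℝ P.F x) y} := by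
    rw [hP.adjoint_fderiv_F]
    simp only [Problem.D, convexHull_singleton, Set.smul_set_singleton]
    exact (map_sum (Set.singletonAddMonoidHom (α := E n)) _ _).symm
  rw [hD, Set.singleton_add_singleton]
  exact Set.mem_add.2 ⟨_, rfl, _, hX, by abel⟩

namespace ApproxStationary

theorem infEDist_le (hP : P.Assumptions) {ε : ℝ} {x : E n} (hx : ApproxStationary P ε x) :
    ∃ y z, Metric.infEDist 0 (P.S x y z) ≤ ENNReal.ofReal ε := by
  obtain ⟨y, z, u, hy, hle, hu⟩ := hx
  let w : WithLp 2 (E m × WithLp 2 (E m × E n)) :=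
    WithLp.toLp 2 (P.F x - z, WithLp.toLp 2 (0, u))
  have hw : w ∈ P.S x y z := hP.mem_S rfl (by simpa [w] using hy) hu
  have hnorm : ‖w‖ = √(‖P.F x - z‖ ^ 2 + ‖u‖ ^ 2) := by
    simp [w, WithLp.prod_norm_eq_of_L2]
  refine ⟨y, z, (Metric.infEDist_le_edist_of_mem hw).trans ?_⟩
  rw [edist_dist, dist_zero_left, hnorm]
  refine ENNReal.ofReal_le_ofReal (le_trans (Real.sqrt_le_iff.2 ⟨by positivity, ?_⟩) hle)
  nlinarith [norm_nonneg (P.F x - z), norm_nonneg u]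

theorem exists_zero_mem_S (hP : P.Assumptions) {x : E n} (hx : ApproxStationary P 0 x) :
    ∃ y, 0 ∈ P.S x y (P.F x) := by
  obtain ⟨y, z, u, hy, hle, hu⟩ := hx
  obtain rfl : u = 0 := norm_le_zero_iff.1 (by linarith [norm_nonneg (P.F x - z)])
  obtain rfl : P.F x = z := sub_eq_zero.1 (norm_le_zero_iff.1 (by linarith [norm_nonneg (0 : E n)]))
  exact ⟨y, hP.mem_S (by simp) (by simpa using hy) (by simpa using hu)⟩

theorem of_tendsto (hP : P.Assumptions) {x : ℕ → E n} {x₀ : E n} {ε : ℕ → ℝ}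
    (hε : Tendsto ε atTop (𝓝 0)) (hx : Tendsto x atTop (𝓝 x₀))
    (happrox : ∀ k, ApproxStationary P (ε k) (x k)) : ApproxStationary P 0 x₀ := by
  choose y z u hy hle hu using happrox
  obtain ⟨K, hK⟩ := hP.exists_lipschitzWith_h
  obtain ⟨y₀, -, φ, hφ, hy₀⟩ := (isCompact_closedBall (0 : E m) K).tendsto_subseq (x := y)
    (fun k => by simpa using norm_le_of_mem_subdiff hK (hy k))
  have hu₀ : Tendsto u atTop (𝓝 0) :=
    squeeze_zero_norm (fun k => by linarith [hle k, norm_nonneg (P.F (x k) - z k)]) hε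
  have hFx : Tendsto (fun k => P.F (x k)) atTop (𝓝 (P.F x₀)) :=
    (hP.contDiff_F.continuous.tendsto x₀).comp hx
  have hz₀ : Tendsto z atTop (𝓝 (P.F x₀)) := by
    have hdiff : Tendsto (fun k => P.F (x k) - z k) atTop (𝓝 0) :=
      squeeze_zero_norm (fun k => by linarith [hle k, norm_nonneg (u k)]) hε
    simpa using hFx.sub hdiff
  have hxφ := hx.comp hφ.tendsto_atTop
  have hadj : Tendsto (fun k => ContinuousLinearMap.adjoint (fderiv ℝ P.F (x (φ k))) (y (φ k)))
      atTop (𝓝 (ContinuousLinearMap.adjoint (fderiv ℝ P.F x₀) y₀)) :=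
    (isBoundedBilinearMap_apply.continuous.tendsto _).comp
      ((((ContinuousLinearMap.adjoint.continuous.comp hP.continuous_fderiv_F).tendsto x₀).comp
        hxφ).prodMk_nhds hy₀)
  refine ⟨y₀, P.F x₀, 0, mem_subdiff_of_tendsto hP.continuous_h hy₀ (hz₀.comp hφ.tendsto_atTop)
    fun k => hy _, by simp, mem_normalCone_of_tendsto hP.closed_X ?_ hxφ fun k => hu (φ k)⟩
  exact ((hu₀.comp hφ.tendsto_atTop).sub
    (((continuous_gradient hP.smooth_f₀).tendsto _).comp hxφ)).sub hadj

end ApproxStationary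

/-! ### Trial points with small predicted decrease are nearly stationary -/

namespace Constants

/-- The error up to which a trial point of predicted decrease `v` is stationary. Here `√(tmax v)`
bounds the length of the step, and `√v` the perturbation that turns the model subgradient into a
subgradient of `h`. -/
noncomputable def residual (c : Constants) (A : Params n) (v : ℝ) : ℝ :=
  c.LF * √(A.tmax * v) ^ 2 + c.G * √(A.tmax * v) + √v +
    ((c.LF * √(A.tmax * v) + c.G) * √v + c.LF * √(A.tmax * v) * c.Lh + √(A.tmax * v) / c.tmin)

theorem continuous_residual (c : Constants) (A : Params n) : Continuous (c.residual A) := by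
  unfold residual
  fun_prop

theorem residual_zero (c : Constants) (A : Params n) : c.residual A 0 = 0 := by
  simp [residual]

namespace Valid

theorem residual_nonneg (hc : c.Valid P A) (v : ℝ) : 0 ≤ c.residual A v := by
  have := hc.tmin_pos
  unfold residual
  positivity

theorem monotone_residual (hc : c.Valid P A) (hA : A.Valid P) : Monotone (c.residual A) := by
  intro v w hvw
  have htmin := hc.tmin_pos
  have htmax := hA.tmax_pos
  unfold residual
  gcongr

variable {x x' : E n} {δ : ℝ}

theorem norm_fderiv_F_sub_le (hc : c.Valid P A) (hx : x ∈ P.X) (hx' : x' ∈ P.X)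
    (hδ : ‖x' - x‖ ≤ δ) : ‖fderiv ℝ P.F x' - fderiv ℝ P.F x‖ ≤ c.LF * δ := by
  rw [← dist_eq_norm] at hδ ⊢
  exact (hc.lipschitz_fderiv_F.dist_le_mul _ hx' _ hx).trans (by gcongr)

theorem norm_fderiv_F_le_add (hc : c.Valid P A) (hx : x ∈ P.X) (hobj : P.obj x ≤ P.obj A.x₀)
    (hx' : x' ∈ P.X) (hδ : ‖x' - x‖ ≤ δ) : ‖fderiv ℝ P.F x'‖ ≤ c.LF * δ + c.G :=
  (norm_le_norm_sub_add _ _).trans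
    (add_le_add (hc.norm_fderiv_F_sub_le hx hx' hδ) (hc.norm_fderiv_F_le x hx hobj))

theorem norm_F_sub_le (hc : c.Valid P A) (hP : P.Assumptions) (hx : x ∈ P.X)
    (hobj : P.obj x ≤ P.obj A.x₀) (hx' : x' ∈ P.X) (hδ : ‖x' - x‖ ≤ δ) :
    ‖P.F x' - P.F x‖ ≤ c.LF * δ ^ 2 + c.G * δ := by
  have hsplit : P.F x' - P.F x = P.F x' - (P.F x + fderiv ℝ P.F x (x' - x))
      + fderiv ℝ P.F x (x' - x) := by abel
  rw [hsplit]
  refine (norm_add_le _ _).trans (add_le_add ?_ ?_)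
  · exact (norm_sub_linearization_le hP.convex_X (fun x _ => hP.differentiable_F x)
      hc.lipschitz_fderiv_F hx hx').trans (by gcongr)
  · exact ContinuousLinearMap.le_of_opNorm_le_of_le _ (hc.norm_fderiv_F_le x hx hobj) hδ

end Valid

end Constants

theorem IsTrial.approx_subgradient (hs : IsLowerModel P.h s.model) (hT : IsTrial P s T) (w : E m) :
    P.h (P.F s.center) + inner ℝ T.y (w - P.F s.center)
      - (P.h (P.F s.center) - s.model T.z - inner ℝ T.y (P.F s.center - T.z)) ≤ P.h w := by
  have hle := (hT.y_mem w).trans (hs.2 w)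
  rw [← sub_add_sub_cancel w (P.F s.center) T.z, inner_add_right] at hle
  linarith

namespace State.Admissible

theorem norm_sub_center_le (hP : P.Assumptions) (hs : s.Admissible P A) (hT : IsTrial P s T) :
    ‖T.x - s.center‖ ≤ √(A.tmax * predDecrease P s T) := by
  refine Real.le_sqrt_of_sq_le ?_
  have ht := hs.t_pos
  calc ‖T.x - s.center‖ ^ 2 = s.t * (1 / s.t * ‖T.x - s.center‖ ^ 2) := by field_simp
    _ ≤ A.tmax * predDecrease P s T :=
      mul_le_mul hs.t_le (hs.norm_sq_le hP hT) (by positivity) (ht.le.trans hs.t_le)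

theorem linearization_gap_le (hP : P.Assumptions) (hs : s.Admissible P A) (hT : IsTrial P s T) :
    P.h (P.F s.center) - s.model T.z - inner ℝ T.y (P.F s.center - T.z) ≤ predDecrease P s T := by
  have ht := hs.t_pos
  have hstep : 0 ≤ 1 / s.t * ‖T.x - s.center‖ ^ 2 := by positivity
  linarith [hT.le_predDecrease hP hs.center_mem]

theorem exists_mem_subdiff_h_near (hP : P.Assumptions) (hs : s.Admissible P A)
    (hT : IsTrial P s T) :
    ∃ z, ∃ y ∈ subdiff P.h z, ‖z - P.F s.center‖ ≤ √(predDecrease P s T) ∧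
      ‖y - T.y‖ ≤ √(predDecrease P s T) := by
  obtain ⟨z, y, hy, hz, hyT⟩ :=
    exists_mem_subdiff_near hP.convex_h (hT.approx_subgradient hs.lower)
  have hgap := hs.linearization_gap_le hP hT
  exact ⟨z, y, hy, Real.le_sqrt_of_sq_le (hz.trans hgap), Real.le_sqrt_of_sq_le (hyT.trans hgap)⟩

theorem approxStationary (hP : P.Assumptions) (hc : c.Valid P A) (hs : s.Admissible P A)
    (htmin : c.tmin ≤ s.tlow) (hT : IsTrial P s T) :
    ApproxStationary P (c.residual A (predDecrease P s T)) T.x := by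
  obtain ⟨z, y, hy, hz, hyT⟩ := hs.exists_mem_subdiff_h_near hP hT
  have hδ := hs.norm_sub_center_le hP hT
  have hTX := hT.x_opt.1
  have ht := hs.t_pos
  refine ⟨y, z, ContinuousLinearMap.adjoint (fderiv ℝ P.F T.x) (y - T.y)
    + ContinuousLinearMap.adjoint (fderiv ℝ P.F T.x - fderiv ℝ P.F s.center) T.y
    - (1 / s.t) • (T.x - s.center), hy, add_le_add ?_ ?_, ?_⟩
  · rw [← sub_add_sub_cancel (P.F T.x) (P.F s.center) z]
    refine (norm_add_le _ _).trans (add_le_add ?_ (by rwa [norm_sub_rev]))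
    exact hc.norm_F_sub_le hP hs.center_mem hs.obj_le hTX hδ
  · refine (norm_sub_le _ _).trans (add_le_add ((norm_add_le _ _).trans (add_le_add ?_ ?_)) ?_)
    · refine ContinuousLinearMap.le_of_opNorm_le_of_le _ ?_ hyT
      rw [LinearIsometryEquiv.norm_map]
      exact hc.norm_fderiv_F_le_add hs.center_mem hs.obj_le hTX hδ
    · refine ContinuousLinearMap.le_of_opNorm_le_of_le _ ?_
        (norm_le_of_mem_subdiff (hs.lower.lipschitzWith hc.lipschitz_h) hT.y_mem)
      rw [LinearIsometryEquiv.norm_map]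
      exact hc.norm_fderiv_F_sub_le hs.center_mem hTX hδ
    · rw [norm_smul, Real.norm_of_nonneg (by positivity), one_div, inv_mul_eq_div]
      exact div_le_div₀ (Real.sqrt_nonneg _) hδ hc.tmin_pos (htmin.trans hs.tlow_le)
  · convert hT.x_opt using 1
    rw [map_sub, map_sub, sub_apply]
    abel

theorem x_eq_center_of_predDecrease_eq_zero (hP : P.Assumptions) (hs : s.Admissible P A)
    (hT : IsTrial P s T) (hv : predDecrease P s T = 0) : T.x = s.center := by
  have hle := hs.norm_sub_center_le hP hT
  rw [hv, mul_zero, Real.sqrt_zero] at hle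
  exact sub_eq_zero.1 (norm_le_zero_iff.1 hle)

end State.Admissible

/-! ### Executions that never stop -/

variable {r : Run n m}

namespace Run

/-- An execution that never stops, with positive predicted decreases. -/
structure IsInfinite (P : Problem n m) (A : Params n) (r : Run n m) : Prop where
  init : IsInit P A (r.state 0)
  trial : ∀ k, IsTrial P (r.state k) (r.trial k)
  v_pos : ∀ k, 0 < r.v P k
  update : ∀ k, Update P A (r.state k) (r.trial k) (r.state (k + 1))

/-- Iteration `k` passes both descent tests, so that it ends in a serious step. -/
def IsSerious (P : Problem n m) (A : Params n) (r : Run n m) (k : ℕ) : Prop :=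
  Test₁ P A (r.state k) (r.trial k) ∧ Test₂ P A (r.state k) (r.trial k)

/-- Iteration `k` fails the first descent test, so that it ends in a null step. -/
def IsNull (P : Problem n m) (A : Params n) (r : Run n m) (k : ℕ) : Prop :=
  ¬ Test₁ P A (r.state k) (r.trial k)

/-- The optimal value of the master problem in iteration `k`. -/
noncomputable def masterValue (P : Problem n m) (r : Run n m) (k : ℕ) : ℝ :=
  P.f₀ (r.next k) + (r.state k).model (r.trial k).z
    + 1 / (2 * (r.state k).t) * ‖r.next k - r.center k‖ ^ 2

theorem IsNull.not_isSerious {k : ℕ} (hk : r.IsNull P A k) : ¬ r.IsSerious P A k := fun h => hk h.1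

theorem IsExecution.isInfinite {Tol : ℝ} (hTol : 0 ≤ Tol) (hr : r.IsExecution P A Tol)
    (hv : ∀ k, Tol < r.v P k) : r.IsInfinite P A where
  init := hr.1
  trial k := (hr.2 k fun j _ => hv j).1
  v_pos k := hTol.trans_lt (hv k)
  update k := (hr.2 k fun j _ => hv j).2 (hv k)

namespace IsInfinite

theorem isPartial (hr : r.IsInfinite P A) (k : ℕ) : r.IsPartial P A 0 k :=
  ⟨hr.init, fun j _ _ => ⟨hr.trial j, fun _ => hr.update j⟩⟩

theorem admissible (hr : r.IsInfinite P A) (hP : P.Assumptions) (hA : A.Valid P) (k : ℕ) :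
    (r.state k).Admissible P A :=
  (hr.isPartial k).admissible hP hA fun j _ => hr.v_pos j

theorem tmin_le_tlow (hr : r.IsInfinite P A) (hP : P.Assumptions) (hA : A.Valid P)
    (hc : c.Valid P A) (k : ℕ) : c.tmin ≤ (r.state k).tlow :=
  (hr.isPartial k).tmin_le_tlow hP hA hc fun j _ => hr.v_pos j

theorem nullStep (hr : r.IsInfinite P A) {k : ℕ} (hk : r.IsNull P A k) :
    NullStep P (r.state k) (r.trial k) (r.state (k + 1)) :=
  (hr.update k).2.2 hk

theorem center_succ (hr : r.IsInfinite P A) {k : ℕ} (hk : ¬ r.IsSerious P A k) :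
    r.center (k + 1) = r.center k := by
  rcases update_iff.1 (hr.update k) with ⟨h₁, h₂, -⟩ | ⟨-, -, hstep⟩ | ⟨-, hstep⟩
  · exact absurd ⟨h₁, h₂⟩ hk
  · exact hstep.center_eq
  · exact hstep.center_eq

theorem center_eq_of_le (hr : r.IsInfinite P A) {N k : ℕ} (hk : N ≤ k)
    (hser : ∀ j, N ≤ j → j < k → ¬ r.IsSerious P A j) : r.center k = r.center N := by
  induction k, hk using Nat.le_induction with
  | base => rfl
  | succ k hk ih =>
    rw [hr.center_succ (hser k hk k.lt_succ_self),
      ih fun j hj hjk => hser j hj (hjk.trans k.lt_succ_self)]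

theorem obj_succ_le_of_isSerious (hr : r.IsInfinite P A) {k : ℕ} (hk : r.IsSerious P A k) :
    P.obj (r.center (k + 1)) ≤ P.obj (r.center k) - A.κ / 2 * r.v P k := by
  have hcenter : r.center (k + 1) = r.next k := ((hr.update k).1 hk.1 hk.2).center_eq
  rw [hcenter]
  exact hk.2

theorem obj_succ_le (hr : r.IsInfinite P A) (hA : A.Valid P) (k : ℕ) :
    P.obj (r.center (k + 1)) ≤ P.obj (r.center k) := by
  by_cases hk : r.IsSerious P A k
  · exact (hr.obj_succ_le_of_isSerious hk).trans
      (sub_le_self _ (mul_pos (half_pos hA.κ_pos) (hr.v_pos k)).le)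
  · rw [hr.center_succ hk]

theorem exists_v_lt_of_frequently_isSerious (hr : r.IsInfinite P A) (hP : P.Assumptions)
    (hA : A.Valid P) (hlev : P.LevelBounded A.x₀) (hser : ∃ᶠ k in atTop, r.IsSerious P A k)
    {ε : ℝ} (hε : 0 < ε) :
    ∀ᶠ N in atTop, ∃ k ≥ N, r.center k = r.center N ∧ r.v P k < ε := by
  obtain ⟨b, hb⟩ := (hP.isCompact_level hlev).bddBelow_image hP.continuous_obj.continuousOn
  have hdecrements : Tendsto (fun k => P.obj (r.center k) - P.obj (r.center (k + 1)))
      atTop (𝓝 0) :=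
    tendsto_sub_succ_of_le (.of_forall (hr.obj_succ_le hA)) <| .of_forall fun k =>
      hb ⟨_, ⟨(hr.admissible hP hA k).center_mem, (hr.admissible hP hA k).obj_le⟩, rfl⟩
  have hκ : 0 < A.κ / 2 := half_pos hA.κ_pos
  obtain ⟨N₀, hN₀⟩ :=
    eventually_atTop.1 (hdecrements.eventually_lt_const (mul_pos hκ hε))
  filter_upwards [eventually_ge_atTop N₀] with N hN
  classical
  have hnext : ∃ k ≥ N, r.IsSerious P A k := frequently_atTop.1 hser N
  obtain ⟨hk, hks⟩ := Nat.find_spec hnext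
  refine ⟨_, hk, hr.center_eq_of_le hk fun j hj hjk h => Nat.find_min hnext hjk ⟨hj, h⟩, ?_⟩
  refine lt_of_mul_lt_mul_left ?_ hκ.le
  linarith [hN₀ _ (hN.trans hk), hr.obj_succ_le_of_isSerious hks]

-- Each backtracking step decreases `t` by at least the fixed amount `tmin * (1 - τ⁻¹)`.
theorem eventually_isNull (hr : r.IsInfinite P A) (hP : P.Assumptions) (hA : A.Valid P)
    (hc : c.Valid P A) (hser : ∀ᶠ k in atTop, ¬ r.IsSerious P A k) :
    ∀ᶠ k in atTop, r.IsNull P A k := by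
  have hτ : 0 < 1 - A.τ⁻¹ := sub_pos.2 (inv_lt_one_of_one_lt₀ hA.one_lt_τ)
  have htmin : ∀ k, c.tmin ≤ (r.state k).t := fun k =>
    (hr.tmin_le_tlow hP hA hc k).trans (hr.admissible hP hA k).tlow_le
  have hback : ∀ k, ¬ r.IsSerious P A k → ¬ r.IsNull P A k →
      c.tmin * (1 - A.τ⁻¹) ≤ (r.state k).t - (r.state (k + 1)).t := by
    intro k hks hkn
    have h₁ : Test₁ P A (r.state k) (r.trial k) := not_not.1 hkn
    rw [((hr.update k).2.1 h₁ fun h₂ => hks ⟨h₁, h₂⟩).t_eq, div_eq_mul_inv, ← mul_one_sub]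
    exact mul_le_mul_of_nonneg_right (htmin k) hτ.le
  have hdecrease : ∀ᶠ k in atTop, (r.state (k + 1)).t ≤ (r.state k).t := by
    filter_upwards [hser] with k hks
    by_cases hkn : r.IsNull P A k
    · exact (hr.nullStep hkn).t_mem.2
    · linarith [hback k hks hkn, mul_pos hc.tmin_pos hτ]
  have hlim := tendsto_sub_succ_of_le hdecrease (.of_forall htmin)
  filter_upwards [hser, hlim.eventually_lt_const (mul_pos hc.tmin_pos hτ)] with k hks hlt
  by_contra hkn
  exact (hback k hks hkn).not_gt hlt

theorem masterValue_add_le_obj (hr : r.IsInfinite P A) (hP : P.Assumptions) (hA : A.Valid P)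
    (k : ℕ) :
    r.masterValue P k + 1 / (2 * A.tmax) * ‖r.next k - r.center k‖ ^ 2
      ≤ P.obj (r.center k) := by
  have hs := hr.admissible hP hA k
  have ht := hs.t_pos
  have hgrowth := (hr.trial k).growth hP hs.center_mem
  rw [sub_self, map_zero, add_zero, norm_zero, norm_sub_rev (r.state k).center] at hgrowth
  have hgap := (hr.trial k).linearization_gap_nonneg hs.lower
  have htmax : 1 / (2 * A.tmax) * ‖r.next k - r.center k‖ ^ 2
      ≤ 1 / (2 * (r.state k).t) * ‖r.next k - r.center k‖ ^ 2 := by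
    gcongr
    exact hs.t_le
  unfold masterValue Problem.obj Run.center Run.next at *
  linarith

-- The new model dominates the aggregate linearization, whose master problem has the same solution
-- and, by strong convexity, grows quadratically around it.
theorem masterValue_add_le_succ (hr : r.IsInfinite P A) (hP : P.Assumptions) (hA : A.Valid P)
    {k : ℕ} (hk : r.IsNull P A k) :
    r.masterValue P k + 1 / (2 * A.tmax) * ‖r.next (k + 1) - r.next k‖ ^ 2
      ≤ r.masterValue P (k + 1) := by
  have hs := hr.admissible hP hA k
  have ht := hs.t_pos
  have ht' := (hr.admissible hP hA (k + 1)).t_pos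
  have hstep := hr.nullStep hk
  have hz := (hr.trial (k + 1)).z_eq
  rw [hstep.center_eq] at hz
  have hgrowth := (hr.trial k).growth hP (hr.trial (k + 1)).x_opt.1
  rw [← hz] at hgrowth
  have hmodel := hstep.model.2.2.2 (r.trial (k + 1)).z
  have hprox : 1 / (2 * (r.state k).t) * ‖r.next (k + 1) - r.center k‖ ^ 2
      ≤ 1 / (2 * (r.state (k + 1)).t) * ‖r.next (k + 1) - r.center k‖ ^ 2 := by
    gcongr
    exact hstep.t_mem.2
  have htmax : 1 / (2 * A.tmax) * ‖r.next (k + 1) - r.next k‖ ^ 2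
      ≤ 1 / (2 * (r.state k).t) * ‖r.next (k + 1) - r.next k‖ ^ 2 := by
    gcongr
    exact hs.t_le
  unfold masterValue
  rw [hr.center_succ hk.not_isSerious]
  unfold Run.center Run.next at *
  linarith

-- The new model dominates the linearization of `h` at `z`, where the first test has failed.
theorem v_succ_le (hr : r.IsInfinite P A) (hP : P.Assumptions) (hA : A.Valid P)
    (hc : c.Valid P A) {k : ℕ} (hk : r.IsNull P A k) {M : ℝ}
    (hM : ‖gradient P.f₀ (r.next k)‖ ≤ M) :
    r.v P (k + 1) ≤ A.κ * r.v P k + (M + c.Lh * c.G) * ‖r.next (k + 1) - r.next k‖ := by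
  have hs := hr.admissible hP hA k
  have hstep := hr.nullStep hk
  obtain ⟨g, hg, hminor⟩ := hstep.model.2.2.1
  have hz : (r.trial (k + 1)).z - (r.trial k).z
      = fderiv ℝ P.F (r.state k).center (r.next (k + 1) - r.next k) := by
    rw [(hr.trial (k + 1)).z_eq, hstep.center_eq, (hr.trial k).linearization_sub_z]
    rfl
  have hh : -inner ℝ g ((r.trial (k + 1)).z - (r.trial k).z)
      ≤ c.Lh * (c.G * ‖r.next (k + 1) - r.next k‖) := by
    rw [hz]
    exact neg_inner_le_mul_norm (norm_le_of_mem_subdiff hc.lipschitz_h hg)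
      (ContinuousLinearMap.le_of_opNorm_le _ (hc.norm_fderiv_F_le _ hs.center_mem hs.obj_le) _)
  have hf₀ : -inner ℝ (gradient P.f₀ (r.next k)) (r.next (k + 1) - r.next k)
      ≤ M * ‖r.next (k + 1) - r.next k‖ := neg_inner_le_mul_norm hM le_rfl
  have hmodel := hminor (r.trial (k + 1)).z
  have hconvex := gradient_mem_subdiff (hP.differentiable_f₀ (r.next k)) hP.convex_f₀
    (r.next (k + 1))
  unfold IsNull Test₁ at hk
  unfold Run.v
  unfold predDecrease at hk ⊢
  rw [hstep.center_eq]
  unfold Run.next at *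
  linarith

section EventuallyNull

variable {K : ℕ}

theorem center_eq_of_forall_isNull (hr : r.IsInfinite P A) (hK : ∀ k ≥ K, r.IsNull P A k) :
    ∀ k ≥ K, r.center k = r.center K := fun _ hk =>
  hr.center_eq_of_le hk fun j hj _ => (hK j hj).not_isSerious

theorem masterValue_le_succ (hr : r.IsInfinite P A) (hP : P.Assumptions) (hA : A.Valid P) {k : ℕ}
    (hk : r.IsNull P A k) : r.masterValue P k ≤ r.masterValue P (k + 1) := by
  have htmax := hA.tmax_pos
  exact (le_add_of_nonneg_right (by positivity)).trans (hr.masterValue_add_le_succ hP hA hk)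

theorem norm_next_sub_center_le (hr : r.IsInfinite P A) (hP : P.Assumptions) (hA : A.Valid P)
    (hK : ∀ k ≥ K, r.IsNull P A k) : ∀ k ≥ K, ‖r.next k - r.center K‖
      ≤ √(2 * A.tmax * (P.obj (r.center K) - r.masterValue P K)) := by
  intro k hk
  have hmono : r.masterValue P K ≤ r.masterValue P k := by
    induction k, hk using Nat.le_induction with
    | base => exact le_rfl
    | succ k hk ih => exact ih.trans (hr.masterValue_le_succ hP hA (hK k hk))
  have hobj := hr.masterValue_add_le_obj hP hA k
  rw [hr.center_eq_of_forall_isNull hK k hk] at hobj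
  refine Real.le_sqrt_of_sq_le ((inv_mul_le_iff₀ (mul_pos two_pos hA.tmax_pos)).1 ?_)
  rw [← one_div]
  linarith

theorem tendsto_norm_next_sub (hr : r.IsInfinite P A) (hP : P.Assumptions) (hA : A.Valid P)
    (hK : ∀ k ≥ K, r.IsNull P A k) :
    Tendsto (fun k => ‖r.next (k + 1) - r.next k‖) atTop (𝓝 0) := by
  have htmax := hA.tmax_pos
  have hdecrements : Tendsto (fun k => -r.masterValue P k - -r.masterValue P (k + 1))
      atTop (𝓝 0) := by
    refine tendsto_sub_succ_of_le (b := -P.obj (r.center K)) ?_ ?_ <;>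
      filter_upwards [eventually_ge_atTop K] with k hk
    · exact neg_le_neg (hr.masterValue_le_succ hP hA (hK k hk))
    · rw [← hr.center_eq_of_forall_isNull hK k hk]
      exact neg_le_neg ((le_add_of_nonneg_right (by positivity)).trans
        (hr.masterValue_add_le_obj hP hA k))
  have hsqrt : Tendsto (fun k => √(2 * A.tmax * (-r.masterValue P k - -r.masterValue P (k + 1))))
      atTop (𝓝 0) := by
    simpa only [mul_zero, Real.sqrt_zero] using (hdecrements.const_mul (2 * A.tmax)).sqrt
  refine squeeze_zero' (.of_forall fun _ => norm_nonneg _) ?_ hsqrt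
  filter_upwards [eventually_ge_atTop K] with k hk
  refine Real.le_sqrt_of_sq_le ((inv_mul_le_iff₀ (by positivity)).1 ?_)
  rw [← one_div]
  linarith [hr.masterValue_add_le_succ hP hA (hK k hk)]

theorem tendsto_v (hr : r.IsInfinite P A) (hP : P.Assumptions) (hA : A.Valid P)
    (hc : c.Valid P A) (hK : ∀ k ≥ K, r.IsNull P A k) : Tendsto (r.v P) atTop (𝓝 0) := by
  obtain ⟨M, hM⟩ := (isCompact_closedBall (r.center K)
    √(2 * A.tmax * (P.obj (r.center K) - r.masterValue P K))).exists_bound_of_continuousOn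
      (continuous_gradient hP.smooth_f₀).continuousOn
  refine tendsto_zero_of_succ_le_mul_add hA.κ_pos.le hA.κ_lt (fun k => (hr.v_pos k).le) ?_
    (e := fun k => (M + c.Lh * c.G) * ‖r.next (k + 1) - r.next k‖) ?_
  · filter_upwards [eventually_ge_atTop K] with k hk
    exact hr.v_succ_le hP hA hc (hK k hk)
      (hM _ (mem_closedBall_iff_norm.2 (hr.norm_next_sub_center_le hP hA hK k hk)))
  · simpa only [mul_zero] using (hr.tendsto_norm_next_sub hP hA hK).const_mul (M + c.Lh * c.G)

end EventuallyNull

theorem exists_v_lt (hr : r.IsInfinite P A) (hP : P.Assumptions) (hA : A.Valid P)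
    (hlev : P.LevelBounded A.x₀) (hc : c.Valid P A) {ε : ℝ} (hε : 0 < ε) :
    ∀ᶠ N in atTop, ∃ k ≥ N, r.center k = r.center N ∧ r.v P k < ε := by
  by_cases hser : ∃ᶠ k in atTop, r.IsSerious P A k
  · exact hr.exists_v_lt_of_frequently_isSerious hP hA hlev hser hε
  · obtain ⟨K, hK⟩ := eventually_atTop.1
      (hr.eventually_isNull hP hA hc (not_frequently.1 hser))
    filter_upwards [(hr.tendsto_v hP hA hc hK).eventually_lt_const hε] with N hN
    exact ⟨N, le_rfl, rfl, hN⟩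

theorem liminf_v (hr : r.IsInfinite P A) (hP : P.Assumptions) (hA : A.Valid P)
    (hlev : P.LevelBounded A.x₀) (hc : c.Valid P A) :
    liminf (fun k => ((r.v P k : ℝ) : EReal)) atTop = 0 := by
  refine le_antisymm (le_of_forall_gt_imp_ge_of_dense fun b hb => ?_) ?_
  · obtain ⟨ε, hε, hεb⟩ := EReal.lt_iff_exists_real_btwn.1 hb
    have hfreq : ∃ᶠ k in atTop, r.v P k < ε := frequently_atTop.2 fun N => by
      obtain ⟨N', ⟨k, hk, -, hv⟩, hN⟩ :=
        ((hr.exists_v_lt hP hA hlev hc (EReal.coe_pos.1 hε)).and (eventually_ge_atTop N)).exists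
      exact ⟨k, hN.trans hk, hv⟩
    exact (liminf_le_of_frequently_le' (hfreq.mono fun k hk => EReal.coe_le_coe hk.le)).trans
      hεb.le
  · exact le_liminf_of_le (by isBoundedDefault)
      (.of_forall fun k => EReal.coe_nonneg.2 (hr.v_pos k).le)

theorem exists_tendsto_of_mapClusterPt (hr : r.IsInfinite P A) (hP : P.Assumptions)
    (hA : A.Valid P) (hlev : P.LevelBounded A.x₀) (hc : c.Valid P A) {x : E n}
    (hx : MapClusterPt x atTop r.center) :
    ∃ k : ℕ → ℕ, Tendsto (fun j => r.center (k j)) atTop (𝓝 x) ∧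
      Tendsto (fun j => r.v P (k j)) atTop (𝓝 0) := by
  have hinv : Tendsto (fun j : ℕ => 1 / ((j : ℝ) + 1)) atTop (𝓝 0) :=
    tendsto_one_div_add_atTop_nhds_zero_nat
  have hnear : ∀ j : ℕ, ∃ k, dist (r.center k) x < 1 / ((j : ℝ) + 1) ∧
      r.v P k < 1 / ((j : ℝ) + 1) := by
    intro j
    have hpos : (0 : ℝ) < 1 / ((j : ℝ) + 1) := Nat.one_div_pos_of_nat
    obtain ⟨N, hN, k, -, hk, hv⟩ :=
      ((mapClusterPt_iff_frequently.1 hx _ (Metric.ball_mem_nhds x hpos)).and_eventually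
        (hr.exists_v_lt hP hA hlev hc hpos)).exists
    exact ⟨k, hk ▸ hN, hv⟩
  choose k hdist hv using hnear
  exact ⟨k, tendsto_iff_dist_tendsto_zero.2
      (squeeze_zero (fun _ => dist_nonneg) (fun j => (hdist j).le) hinv),
    squeeze_zero (fun _ => (hr.v_pos _).le) (fun j => (hv j).le) hinv⟩

theorem exists_zero_mem_S_of_mapClusterPt (hr : r.IsInfinite P A) (hP : P.Assumptions)
    (hA : A.Valid P) (hlev : P.LevelBounded A.x₀) (hc : c.Valid P A) {x : E n}
    (hx : MapClusterPt x atTop r.center) : ∃ y, 0 ∈ P.S x y (P.F x) := by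
  obtain ⟨k, hcenter, hv⟩ := hr.exists_tendsto_of_mapClusterPt hP hA hlev hc hx
  have hres : Tendsto (fun j => c.residual A (r.v P (k j))) atTop (𝓝 0) := by
    simpa only [c.residual_zero, Function.comp_def] using
      ((c.continuous_residual A).tendsto 0).comp hv
  have hstep : Tendsto (fun j => r.next (k j) - r.center (k j)) atTop (𝓝 0) := by
    refine squeeze_zero_norm
      (fun j => (hr.admissible hP hA (k j)).norm_sub_center_le hP (hr.trial (k j))) ?_
    simpa only [mul_zero, Real.sqrt_zero, Run.v] using (hv.const_mul A.tmax).sqrt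
  have hnext : Tendsto (fun j => r.next (k j)) atTop (𝓝 x) := by
    simpa only [sub_add_cancel, zero_add] using hstep.add hcenter
  exact (ApproxStationary.of_tendsto hP hres hnext fun j =>
    (hr.admissible hP hA (k j)).approxStationary hP hc (hr.tmin_le_tlow hP hA hc (k j))
      (hr.trial (k j))).exists_zero_mem_S hP

end IsInfinite

/-! ### Executions that stop -/

theorem exists_stopsAt {Tol : ℝ} (hv : ¬ ∀ k, Tol < r.v P k) : ∃ k, r.StopsAt P Tol k := by
  classical
  push Not at hv
  exact ⟨Nat.find hv, fun j hj => not_le.1 (Nat.find_min hv hj), Nat.find_spec hv⟩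

namespace IsExecution

variable {Tol : ℝ} {k : ℕ}

theorem exists_stopsAt_of_pos (hr : r.IsExecution P A Tol) (hP : P.Assumptions) (hA : A.Valid P)
    (hlev : P.LevelBounded A.x₀) (hc : c.Valid P A) (hTol : 0 < Tol) :
    ∃ k, r.StopsAt P Tol k := by
  refine exists_stopsAt fun hv => ?_
  obtain ⟨N, k, -, -, hk⟩ := ((hr.isInfinite hTol.le hv).exists_v_lt hP hA hlev hc hTol).exists
  exact lt_asymm hk (hv k)

theorem approxStationary (hr : r.IsExecution P A Tol) (hP : P.Assumptions) (hA : A.Valid P)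
    (hc : c.Valid P A) (hk : r.Active P Tol k) :
    ApproxStationary P (c.residual A (r.v P k)) (r.next k) :=
  (hr.isPartial.admissible hP hA hk).approxStationary hP hc
    (hr.isPartial.tmin_le_tlow hP hA hc hk) (hr.2 k hk).1

theorem infEDist_le_of_stopsAt (hr : r.IsExecution P A Tol) (hP : P.Assumptions) (hA : A.Valid P)
    (hc : c.Valid P A) (hk : r.StopsAt P Tol k) :
    ∃ y z, Metric.infEDist 0 (P.S (r.next k) y z) ≤ ENNReal.ofReal (c.residual A Tol) := by
  obtain ⟨y, z, hle⟩ := (hr.approxStationary hP hA hc hk.1).infEDist_le hP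
  exact ⟨y, z, hle.trans (ENNReal.ofReal_le_ofReal (hc.monotone_residual hA hk.2))⟩

theorem stationary_of_stopsAt_zero (hr : r.IsExecution P A 0) (hP : P.Assumptions)
    (hA : A.Valid P) (hc : c.Valid P A) (hk : r.StopsAt P 0 k) :
    r.next k = r.center k ∧ ∃ y, 0 ∈ P.S (r.center k) y (P.F (r.center k)) := by
  have hs : (r.state k).Admissible P A := hr.isPartial.admissible hP hA hk.1
  have hT : IsTrial P (r.state k) (r.trial k) := (hr.2 k hk.1).1
  have hv : r.v P k = 0 := le_antisymm hk.2 (hs.predDecrease_nonneg hP hT)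
  have hnext : r.next k = r.center k := hs.x_eq_center_of_predDecrease_eq_zero hP hT hv
  have hstat := hr.approxStationary hP hA hc hk.1
  rw [hv, c.residual_zero, hnext] at hstat
  exact ⟨hnext, hstat.exists_zero_mem_S hP⟩

end IsExecution

end Run

end CompositeBundle

theorem mainTheorem2 {n m : ℕ} (P : CompositeBundle.Problem n m) (hP : P.Assumptions)
    (A : CompositeBundle.Params n) (hA : A.Valid P) (hlev : P.LevelBounded A.x₀) :
    (∀ Tol : ℝ, 0 ≤ Tol → CompositeBundle.WellDefined P A Tol) ∧
    (∀ r : CompositeBundle.Run n m, r.IsExecution P A 0 →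
      (∃ k, r.StopsAt P 0 k ∧ r.next k = r.center k ∧
        ∃ y, 0 ∈ P.S (r.center k) y (P.F (r.center k))) ∨
      ((∀ k, 0 < r.v P k) ∧
        (r.BoundedSubgradients P 0 →
          Filter.liminf (fun k => ((r.v P k : ℝ) : EReal)) Filter.atTop = 0 ∧
          ∀ x : CompositeBundle.E n, MapClusterPt x Filter.atTop r.center →
            ∃ y, 0 ∈ P.S x y (P.F x)))) ∧
    (∃ ε : ℝ → ℝ, (∀ Tol, 0 < Tol → 0 ≤ ε Tol) ∧
      Filter.Tendsto ε (nhdsWithin 0 (Set.Ioi 0)) (nhds 0) ∧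
      ∀ Tol : ℝ, 0 < Tol → ∀ r : CompositeBundle.Run n m, r.IsExecution P A Tol →
        ∃ k, r.StopsAt P Tol k ∧
          ∃ y z, Metric.infEDist 0 (P.S (r.next k) y z) ≤ ENNReal.ofReal (ε Tol)) := by
  obtain ⟨c, hc⟩ := CompositeBundle.Constants.exists_valid hP hA hlev
  refine ⟨fun Tol _ => CompositeBundle.wellDefined hP hA, fun r hr => ?_, c.residual A,
    fun Tol _ => hc.residual_nonneg Tol, ?_, fun Tol hTol r hr => ?_⟩
  · by_cases hv : ∀ k, 0 < r.v P k
    · have hinf : r.IsInfinite P A := hr.isInfinite le_rfl hv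
      exact Or.inr ⟨hv, fun _ => ⟨hinf.liminf_v hP hA hlev hc,
        fun x hx => hinf.exists_zero_mem_S_of_mapClusterPt hP hA hlev hc hx⟩⟩
    · obtain ⟨k, hk⟩ := CompositeBundle.Run.exists_stopsAt hv
      exact Or.inl ⟨k, hk, hr.stationary_of_stopsAt_zero hP hA hc hk⟩
  · have hlim := (c.continuous_residual A).tendsto 0
    rw [c.residual_zero] at hlim
    exact hlim.mono_left nhdsWithin_le_nhds
  · obtain ⟨k, hk⟩ := hr.exists_stopsAt_of_pos hP hA hlev hc hTol
    exact ⟨k, hk, hr.infEDist_le_of_stopsAt hP hA hc hk⟩
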